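/- **Notation.** Let $n\ge 1$ and let $\mathbb H$ be the real quaternions with units $i,j,k$, conjugation $q\mapsto\bar q$ and scalar part $Sc(q)$. Points of $\mathbb R^{2n}$ are written $(x,y)$, where $x\in\mathbb R^n$ consists of the first $n$ coordinates and $y\in\mathbb R^n$ of the last $n$. On $L^2(\mathbb R^{2n},\mathbb H)$ put $(f,g)_Q=\int_{\mathbb R^{2n}} Sc\big(f(x)\overline{g(x)}\big)\,dx$ and $\|f\|_2^2=(f,f)_Q$. The quaternion Fourier transform is $$\mathcal F_Q(f)(u,v)=\int_{\mathbb R^{2n}}e^{-2\pi i\,u\cdot x}f(x,y)\,e^{-2\pi j\,v\cdot y}\,dx\,dy\qquad(f\in L^1\cap L^2),$$ extended by continuity to $L^2(\mathbb R^{2n},\mathbb H)$. For $a\in\mathbb R^*=\mathbb R\setminus\{0\}$ and $s\in\mathbb R^{2n-1}$ let $A_a=\mathrm{diag}\big(a,\ \mathrm{sgn}(a)|a|^{1/(2n)}I_{2n-1}\big)$ and $S_s=\begin{pmatrix}1&s^T\\0&I_{2n-1}\end{pmatrix}$. For $t\in\mathbb R^{2n}$ and $\psi\in L^2(\mathbb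 R^{2n},\mathbb H)$ let $$\psi_{a,s,t}(x)=|a|^{\frac1{4n}-1}\psi\big(A_a^{-1}S_s^{-1}(x-t)\big),\qquad \psi^*(x)=\overline{\psi(-x)}.$$ The function $\psi$ is an *admissible quaternion shearlet* if $$C_\psi=\int_{\mathbb R^{2n}}\frac{|\mathcal F_Q(\psi^*)(\lambda)|^2}{|\lambda_1|^{2n}}\,d\lambda<\infty .$$ Its continuous quaternion shearlet transform is $\mathcal{SH}^Q_\psi f(a,s,t)=\int_{\mathbb R^{2n}}f(x)\,\overline{\psi_{a,s,t}(x)}\,dx$ for $f\in L^2(\mathbb R^{2n},\mathbb H)$. Let $d\mu(a,s,t)=|a|^{-(2n+1)}\,da\,ds\,dt$ on $\mathbb R^*\times\mathbb R^{2n-1}\times\mathbb R^{2n}$; this is the left Haar measure of the shearlet group, whose law is $(a,s,t)\circ(a',s',t')=(aa',\,s+|a|^{1-\frac1{2n}}s',\,t+S_sA_at')$. For $F,G\in L^2(\mu)$ with values in $\mathbb H$ put $\langle F,G\rangle_\mu=\int Sc(F\overline G)\,d\mu$. **Theorem (Parseval and Plancherel for $\mathcal{SH}^Q_\psi$).** Let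 $\psi\in L^2(\mathbb R^{2n},\mathbb H)$ be an admissible quaternion shearlet such that, for almost every $(u,v)\in\mathbb R^n\times\mathbb R^n$ and all $t\in\mathbb R^n$, $$\mathcal F_Q(\psi)(u,v)\,e^{-2\pi j\,v\cdot t}=e^{-2\pi j\,v\cdot t}\,\mathcal F_Q(\psi)(u,v)\quad\text{and}\quad \mathcal F_Q(j\psi)(u,v)\,e^{-2\pi j\,v\cdot t}=j\,e^{-2\pi j\,v\cdot t}\,\mathcal F_Q(\psi)(u,v).$$ Then: 1. For all $f,g\in L^2(\mathbb R^{2n},\mathbb H)$, the transforms $\mathcal{SH}^Q_\psi f$ and $\mathcal{SH}^Q_\psi g$ belong to $L^2(\mu)$ and $\langle\mathcal{SH}^Q_\psi f,\mathcal{SH}^Q_\psi g\rangle_\mu=C_\psi\,(f,g)_Q$. 2. For every $f\in L^2(\mathbb R^{2n},\mathbb H)$, $\displaystyle\int|\mathcal{SH}^Q_\psi f|^2\,d\mu=C_\psi\,\|f\|_2^2$. -/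

import Mathlib

open MeasureTheory Filter Topology
open scoped Quaternion ENNReal Matrix

noncomputable section

namespace QShearlet

/-- The Euclidean space `ℝ^{2n}`. -/
abbrev E (n : ℕ) : Type := EuclideanSpace ℝ (Fin (2 * n))

/-- The Euclidean space `ℝ^{2n-1}` of shear parameters. -/
abbrev P (n : ℕ) : Type := EuclideanSpace ℝ (Fin (2 * n - 1))

/-- The quaternion unit `i`. -/
def qi : ℍ[ℝ] := ⟨0, 1, 0, 0⟩

/-- The quaternion unit `j`. -/
def qj : ℍ[ℝ] := ⟨0, 0, 1, 0⟩

/-- The scalar part `(f, g)_Q = ∫ Sc (f(x) * conj g(x)) dx` of the quaternionic inner product. -/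
def scInner {n : ℕ} (f g : E n → ℍ[ℝ]) : ℝ := ∫ x, (f x * star (g x)).re

/-! ### The two-sided quaternion Fourier transform

A point of `ℝ^{2n}` is read as `(x, y)`, where `x ∈ ℝ^n` consists of the first `n` coordinates and
`y ∈ ℝ^n` of the last `n`. -/

/-- `u · x`, for the first halves of `(u, v)` and `(x, y)`. -/
def dotFst {n : ℕ} (ξ z : E n) : ℝ :=
  ∑ p : Fin n, ξ ⟨p.val, by omega⟩ * z ⟨p.val, by omega⟩

/-- `v · y`, for the second halves of `(u, v)` and `(x, y)`. -/
def dotSnd {n : ℕ} (ξ z : E n) : ℝ :=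
  ∑ p : Fin n, ξ ⟨n + p.val, by omega⟩ * z ⟨n + p.val, by omega⟩

/-- The integral formula
`F_Q(f)(u,v) = ∫ e^{-2π i u·x} f(x,y) e^{-2π j v·y} dx dy`, meaningful for integrable `f`. -/
def qftIntegral {n : ℕ} (f : E n → ℍ[ℝ]) (ξ : E n) : ℍ[ℝ] :=
  ∫ z, NormedSpace.exp ((-(2 * Real.pi * dotFst ξ z)) • qi) * f z *
    NormedSpace.exp ((-(2 * Real.pi * dotSnd ξ z)) • qj)

/-- `F` is (a representative of) the image of `f` under the extension of the quaternion Fourier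
transform from `L¹ ∩ L²` to `L²` by continuity. -/
def IsQFT {n : ℕ} (f F : E n → ℍ[ℝ]) : Prop :=
  MemLp F 2 volume ∧ ∃ φ : ℕ → E n → ℍ[ℝ],
    (∀ k, MemLp (φ k) 1 volume ∧ MemLp (φ k) 2 volume) ∧
    Tendsto (fun k => eLpNorm (fun z => φ k z - f z) 2 volume) atTop (𝓝 0) ∧
    Tendsto (fun k => eLpNorm (fun ξ => qftIntegral (φ k) ξ - F ξ) 2 volume) atTop (𝓝 0)

open Classical in
/-- The quaternion Fourier transform on `L²(ℝ^{2n}, ℍ)`; its values are determined up to a null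
set. -/
def qft {n : ℕ} (f : E n → ℍ[ℝ]) : E n → ℍ[ℝ] :=
  if h : ∃ F, IsQFT f F then h.choose else 0

/-- The commutation hypothesis of the convolution theorem for `F_Q`: for almost every `(u, v)` and
all `t ∈ ℝ^n`, `F_Q(g)(u,v)` commutes with `e^{-2π j v·t}`, and
`F_Q(j g)(u,v) e^{-2π j v·t} = j e^{-2π j v·t} F_Q(g)(u,v)`. -/
def CommutationHyp {n : ℕ} (g : E n → ℍ[ℝ]) : Prop :=
  ∀ᵐ ξ : E n, ∀ t : EuclideanSpace ℝ (Fin n),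
    let e : ℍ[ℝ] := NormedSpace.exp
      ((-(2 * Real.pi * ∑ p : Fin n, ξ ⟨n + p.val, by omega⟩ * t p)) • qj)
    qft g ξ * e = e * qft g ξ ∧ qft (fun z => qj * g z) ξ * e = qj * e * qft g ξ

/-! ### Shearlets -/

/-- The dilation matrix `A_a = diag(a, sgn(a)|a|^{1/(2n)}, …, sgn(a)|a|^{1/(2n)})`. -/
def dilMat (n : ℕ) (a : ℝ) : Matrix (Fin (2 * n)) (Fin (2 * n)) ℝ :=
  Matrix.diagonal fun k =>
    if k.val = 0 then a else Real.sign a * |a| ^ (1 / (2 * n : ℝ))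

/-- The shear matrix `S_s`, with first row `(1, s_1, …, s_{2n-1})` and otherwise the identity. -/
def shearMat {n : ℕ} (s : P n) : Matrix (Fin (2 * n)) (Fin (2 * n)) ℝ :=
  Matrix.of fun k l =>
    if k = l then 1 else if k.val = 0 then s ⟨l.val - 1, by omega⟩ else 0

/-- `ψ_{a,s,t}(x) = |a|^{1/(4n) - 1} ψ(A_a⁻¹ S_s⁻¹ (x - t))`. -/
def shearlet {n : ℕ} (ψ : E n → ℍ[ℝ]) (a : ℝ) (s : P n) (t : E n) (x : E n) : ℍ[ℝ] :=
  (|a| ^ (1 / (4 * n : ℝ) - 1)) •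
    ψ (WithLp.toLp 2 ((dilMat n a)⁻¹ *ᵥ ((shearMat s)⁻¹ *ᵥ (WithLp.ofLp (x - t)))))

/-- `ψ^*(x) = conj (ψ(-x))`. -/
def involution {n : ℕ} (ψ : E n → ℍ[ℝ]) (x : E n) : ℍ[ℝ] := star (ψ (-x))

/-- The admissibility constant `C_ψ = ∫ |F_Q(ψ^*)(λ)|² / |λ_1|^{2n} dλ`, in `[0, ∞]`. -/
def admConst {n : ℕ} [NeZero n] (ψ : E n → ℍ[ℝ]) : ℝ≥0∞ :=
  ∫⁻ ξ : E n, ‖qft (involution ψ) ξ‖ₑ ^ 2 /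
    ENNReal.ofReal (|ξ ⟨0, Nat.mul_pos two_pos (NeZero.pos n)⟩| ^ (2 * n))

/-- `ψ ∈ L²(ℝ^{2n}, ℍ)` is an admissible quaternion shearlet: `C_ψ < ∞`. -/
def Admissible {n : ℕ} [NeZero n] (ψ : E n → ℍ[ℝ]) : Prop :=
  MemLp ψ 2 volume ∧ admConst ψ < ∞

/-- The left Haar measure `dμ(a,s,t) = |a|^{-(2n+1)} da ds dt` of the full shearlet group
`ℝ^* × ℝ^{2n-1} × ℝ^{2n}`, whose law is
`(a,s,t) ∘ (a',s',t') = (a a', s + |a|^{1-1/(2n)} s', t + S_s A_a t')`. It is carried by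
`{a ≠ 0}`. -/
def haarShear (n : ℕ) : Measure (ℝ × P n × E n) :=
  ((volume.restrict {a : ℝ | a ≠ 0}).prod (volume : Measure (P n × E n))).withDensity
    fun q => ENNReal.ofReal (1 / |q.1| ^ (2 * n + 1))

/-- The continuous quaternion shearlet transform
`SH_ψ(f)(a,s,t) = ⟨f, ψ_{a,s,t}⟩_Q = ∫ f(x) conj(ψ_{a,s,t}(x)) dx`. -/
def SH {n : ℕ} (ψ f : E n → ℍ[ℝ]) (q : ℝ × P n × E n) : ℍ[ℝ] :=
  ∫ x, f x * star (shearlet ψ q.1 q.2.1 q.2.2 x)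

/-- The inner product `⟨F, G⟩_μ = ∫ Sc (F conj(G)) dμ` of `L²(μ)`. -/
def innerHaar {n : ℕ} (F G : ℝ × P n × E n → ℍ[ℝ]) : ℝ :=
  ∫ q, (F q * star (G q)).re ∂(haarShear n)

end QShearlet

end

noncomputable section

namespace QShearlet

open scoped FourierTransform SchwartzMap

/-! ### The complex Fourier transform on `L²`. -/

section Complex

/-! Write a quaternion as `z + i w` with `z`, `w` in the plane spanned by `1` and `j`, identified
with `ℂ`. Right multiplication by an element of this plane is complex multiplication on both
components, and left multiplication by `e^{-iθ}` is a rotation mixing them. Hence `F_Q(f)` at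
`(u,v)` is an explicit combination of the complex Fourier transforms of the two components at
`(u,v)` and at `(-u,v)` (`qftIntegral_eq`, and `qft_ae_eq` on `L²`).

The commutation hypothesis forces `F_Q(ψ)` to commute with `j` and `F_Q(jψ) = j F_Q(ψ)` almost
everywhere. Comparing the points `(u,v)` and `(-u,v)` then shows that `ψ` itself takes values in the
`j`-plane (`CommutationHyp.sndC_ae_eq_zero`). So the quaternion shearlet transform is a pair of
complex ones with the same complex shearlet (`SH_eq_mkQ`), and `C_ψ` is the complex admissibility
constant (`admConst_eq`).

In the complex case, for fixed `(a,s)` the transform is, as a function of `t`, a multiple of the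
inverse Fourier transform of `f̂(ξ)` times the conjugate of `ĝ((S_s A_a)ᵀ ξ)`. Plancherel in `t`,
Tonelli, and the substitution `η = (S_s A_a)ᵀ ξ` in `(a,s)` for fixed `ξ` with `ξ₁ ≠ 0` give the
constant times `‖f‖²` (`lintegral_freqMap`, `lintegral_shearCorr_prod`). Adding the two components
gives Plancherel, and polarization gives Parseval. -/

theorem eLpNorm_two_sq {α W : Type*} [MeasurableSpace α] {μ : Measure α}
    [NormedAddCommGroup W] (F : α → W) : eLpNorm F 2 μ ^ 2 = ∫⁻ x, ‖F x‖ₑ ^ 2 ∂μ := by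
  have := eLpNorm_nnreal_pow_eq_lintegral (p := 2) (f := F) (μ := μ) two_ne_zero
  simpa using this

variable {V : Type*} [NormedAddCommGroup V] [InnerProductSpace ℝ V] [FiniteDimensional ℝ V]
  [MeasurableSpace V] [BorelSpace V]

/-- On `L¹ ∩ L²` the `L²` Fourier transform is given by the Fourier integral. -/
theorem fourier_toLp_ae_eq {h : V → ℂ} (h1 : MemLp h 1 volume) (h2 : MemLp h 2 volume) :
    ((𝓕 (h2.toLp h) : Lp ℂ 2 (volume : Measure V)) : V → ℂ) =ᵐ[volume] 𝓕 h := by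
  have hint : Integrable h := memLp_one_iff_integrable.1 h1
  have hcont : Continuous (𝓕 h) := by
    exact VectorFourier.fourierIntegral_continuous Real.continuous_fourierChar
      continuous_inner hint
  apply ae_eq_of_integral_contDiff_smul_eq
  · exact (Lp.memLp _).locallyIntegrable (by norm_num)
  · exact hcont.locallyIntegrable
  · intro g g_smooth g_cpt
    have hg₁ : HasCompactSupport (Complex.ofRealCLM ∘ g) := g_cpt.comp_left rfl
    have hg₂ : ContDiff ℝ (⊤ : ℕ∞) (Complex.ofRealCLM ∘ g) := by fun_prop
    set G : 𝓢(V, ℂ) := hg₁.toSchwartzMap hg₂ with hG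
    have hGg : ∀ x, G x = (g x : ℂ) := fun x => rfl
    -- The `L²` transform agrees with the distributional one; testing it on `G` puts the transform
    -- on `G`, and the multiplication formula moves it back onto the integrable function `h`.
    have key := congrArg (fun T : 𝓢'(V, ℂ) => T G)
      (Lp.fourier_toTemperedDistribution_eq (h2.toLp h))
    simp only [TemperedDistribution.fourier_apply, Lp.toTemperedDistribution_apply] at key
    have e1 : ∫ x, (𝓕 G) x • (h2.toLp h : V → ℂ) x = ∫ x, (𝓕 G) x • h x := by
      apply integral_congr_ae
      filter_upwards [h2.coeFn_toLp] with x hx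
      rw [hx]
    have e2 : ∫ x, (𝓕 (G : V → ℂ)) x • h x = ∫ x, G x • 𝓕 h x := by
      have := VectorFourier.integral_fourierIntegral_smul_eq_flip (μ := volume) (ν := volume)
        (L := innerₗ V) Real.continuous_fourierChar continuous_inner
        (G.integrable (μ := volume)) hint
      rw [flip_innerₗ] at this
      exact this
    rw [e1, SchwartzMap.fourier_coe G, e2] at key
    simp only [hGg] at key
    simpa using key.symm

theorem eLpNorm_fourier {h : V → ℂ} (h1 : MemLp h 1 volume) (h2 : MemLp h 2 volume) :
    eLpNorm (𝓕 h) 2 volume = eLpNorm h 2 volume := by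
  rw [← eLpNorm_congr_ae (fourier_toLp_ae_eq h1 h2), ← eLpNorm_congr_ae h2.coeFn_toLp,
    ← Lp.enorm_def, ← Lp.enorm_def, ← ofReal_norm, ← ofReal_norm,
    Lp.norm_fourier_eq]

theorem eLpNorm_fourierInv {h : V → ℂ} (h1 : MemLp h 1 volume) (h2 : MemLp h 2 volume) :
    eLpNorm (𝓕⁻ h) 2 volume = eLpNorm h 2 volume := by
  have h3 : (𝓕⁻ h : V → ℂ) = (𝓕 h) ∘ (fun x => -x) :=
    funext fun x => Real.fourierInv_eq_fourier_neg h x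
  rw [← eLpNorm_fourier h1 h2, h3, eLpNorm_comp_measurePreserving _
    (Measure.measurePreserving_neg volume)]
  exact (Lp.memLp _).aestronglyMeasurable.congr (fourier_toLp_ae_eq h1 h2)

open Classical in
/-- A representative of the Fourier transform of a square integrable function. -/
def l2Fourier (h : V → ℂ) : V → ℂ :=
  if hh : MemLp h 2 volume then ⇑(𝓕 (hh.toLp h) : Lp ℂ 2 (volume : Measure V)) else 0

theorem l2Fourier_eq {h : V → ℂ} (hh : MemLp h 2 volume) :
    l2Fourier h = ⇑(𝓕 (hh.toLp h) : Lp ℂ 2 (volume : Measure V)) := by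
  rw [l2Fourier, dif_pos hh]

theorem memLp_l2Fourier (h : V → ℂ) : MemLp (l2Fourier h) 2 volume := by
  by_cases hh : MemLp h 2 volume
  · rw [l2Fourier_eq hh]; exact Lp.memLp _
  · rw [l2Fourier, dif_neg hh]; exact MemLp.zero

theorem stronglyMeasurable_l2Fourier (h : V → ℂ) : StronglyMeasurable (l2Fourier h) := by
  by_cases hh : MemLp h 2 volume
  · rw [l2Fourier_eq hh]; exact Lp.stronglyMeasurable _
  · rw [l2Fourier, dif_neg hh]; exact stronglyMeasurable_zero

theorem l2Fourier_ae_eq_fourier {h : V → ℂ} (h1 : MemLp h 1 volume) (h2 : MemLp h 2 volume) :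
    l2Fourier h =ᵐ[volume] 𝓕 h := by
  rw [l2Fourier_eq h2]; exact fourier_toLp_ae_eq h1 h2

/-- This is equality everywhere, since both sides are the same representative of the same class. It
allows the components of `ψ` to be replaced by strongly measurable versions. -/
theorem l2Fourier_congr {h h' : V → ℂ} (e : h =ᵐ[volume] h') : l2Fourier h = l2Fourier h' := by
  by_cases hh : MemLp h 2 volume
  · have hh' : MemLp h' 2 volume := (memLp_congr_ae e).1 hh
    rw [l2Fourier_eq hh, l2Fourier_eq hh', (MemLp.toLp_eq_toLp_iff hh hh').2 e]
  · have hh' : ¬ MemLp h' 2 volume := fun h0 => hh ((memLp_congr_ae e).2 h0)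
    rw [l2Fourier, l2Fourier, dif_neg hh, dif_neg hh']

theorem l2Fourier_add {f g : V → ℂ} (hf : MemLp f 2 volume) (hg : MemLp g 2 volume) :
    l2Fourier (f + g) =ᵐ[volume] l2Fourier f + l2Fourier g := by
  rw [l2Fourier_eq hf, l2Fourier_eq hg, l2Fourier_eq (hf.add hg), MemLp.toLp_add,
    FourierAdd.fourier_add]
  exact Lp.coeFn_add _ _

theorem l2Fourier_const_smul {f : V → ℂ} (c : ℂ) (hf : MemLp f 2 volume) :
    l2Fourier (c • f) =ᵐ[volume] c • l2Fourier f := by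
  rw [l2Fourier_eq hf, l2Fourier_eq (hf.const_smul c), MemLp.toLp_const_smul,
    FourierSMul.fourier_smul]
  exact Lp.coeFn_smul _ _

theorem l2Fourier_sub {f g : V → ℂ} (hf : MemLp f 2 volume) (hg : MemLp g 2 volume) :
    l2Fourier (f - g) =ᵐ[volume] l2Fourier f - l2Fourier g := by
  have e : f - g = f + (-1 : ℂ) • g := by simp [sub_eq_add_neg]
  rw [e]
  filter_upwards [l2Fourier_add hf (hg.const_smul (-1 : ℂ)), l2Fourier_const_smul (-1) hg]
    with x h1 h2
  rw [h1, Pi.add_apply, h2]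
  simp [sub_eq_add_neg]

theorem eLpNorm_l2Fourier {h : V → ℂ} (hh : MemLp h 2 volume) :
    eLpNorm (l2Fourier h) 2 volume = eLpNorm h 2 volume := by
  rw [l2Fourier_eq hh, ← eLpNorm_congr_ae hh.coeFn_toLp, ← Lp.enorm_def, ← Lp.enorm_def,
    ← ofReal_norm, ← ofReal_norm, Lp.norm_fourier_eq]

theorem ae_eq_zero_of_l2Fourier {h : V → ℂ} (hh : MemLp h 2 volume)
    (h0 : l2Fourier h =ᵐ[volume] 0) : h =ᵐ[volume] 0 := by
  rw [← eLpNorm_eq_zero_iff hh.1 two_ne_zero, ← eLpNorm_l2Fourier hh, eLpNorm_congr_ae h0,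
    eLpNorm_zero]

theorem integral_l2Fourier_mul_star {f g : V → ℂ} (hf : MemLp f 2 volume)
    (hg : MemLp g 2 volume) :
    ∫ ξ, l2Fourier f ξ * star (l2Fourier g ξ) = ∫ x, f x * star (g x) := by
  have h := Lp.inner_fourier_eq (hg.toLp g) (hf.toLp f)
  rw [L2.inner_def, L2.inner_def, ← l2Fourier_eq hf, ← l2Fourier_eq hg] at h
  simp only [RCLike.inner_apply] at h
  refine h.trans (integral_congr_ae ?_)
  filter_upwards [hf.coeFn_toLp, hg.coeFn_toLp] with x h1 h2
  rw [h1, h2]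
  rfl

/-- Integrable functions are dense in `L²`. -/
theorem exists_tendsto_eLpNorm {W : Type*} [NormedAddCommGroup W] [NormedSpace ℝ W]
    {f : V → W}
    (hf : MemLp f 2 volume) : ∃ φ : ℕ → V → W,
      (∀ k, MemLp (φ k) 1 volume ∧ MemLp (φ k) 2 volume) ∧
      Tendsto (fun k => eLpNorm (fun z => φ k z - f z) 2 volume) atTop (𝓝 0) := by
  have h : ∀ k : ℕ, ∃ g : V → W, (MemLp g 1 volume ∧ MemLp g 2 volume) ∧
      eLpNorm (fun z => g z - f z) 2 volume ≤ ((k : ℝ≥0∞) + 1)⁻¹ := by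
    intro k
    obtain ⟨g, hg1, hg2, hg3, hg4⟩ := hf.exists_hasCompactSupport_eLpNorm_sub_le
      (ε := ((k : ℝ≥0∞) + 1)⁻¹) (by norm_num) (by simp)
    refine ⟨g, ⟨memLp_one_iff_integrable.2 (hg3.integrable_of_hasCompactSupport hg1), hg4⟩, ?_⟩
    have : (fun z => g z - f z) = -(f - g) := by ext z; simp
    rwa [this, eLpNorm_neg]
  choose φ hφ hφ' using h
  refine ⟨φ, hφ, ?_⟩
  refine tendsto_of_tendsto_of_tendsto_of_le_of_le tendsto_const_nhds ?_ (fun _ => zero_le) hφ'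
  have := (ENNReal.tendsto_inv_nat_nhds_zero).comp (tendsto_add_atTop_nat 1)
  simpa [Function.comp_def] using this

/-- An `L²` limit is determined up to a null set. -/
theorem ae_eq_of_tendsto_eLpNorm {α W : Type*} [MeasurableSpace α] {μ : Measure α}
    [NormedAddCommGroup W] {φ : ℕ → α → W} {F G : α → W}
    (hφ : ∀ k, AEStronglyMeasurable (φ k) μ) (hF : AEStronglyMeasurable F μ)
    (hG : AEStronglyMeasurable G μ)
    (h1 : Tendsto (fun k => eLpNorm (fun z => φ k z - F z) 2 μ) atTop (𝓝 0))
    (h2 : Tendsto (fun k => eLpNorm (fun z => φ k z - G z) 2 μ) atTop (𝓝 0)) :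
    F =ᵐ[μ] G := by
  have h3 : eLpNorm (F - G) 2 μ = 0 := by
    refine le_antisymm (ge_of_tendsto' (by simpa using h1.add h2) fun k => ?_) zero_le
    have : F - G = (fun z => φ k z - G z) - (fun z => φ k z - F z) := by
      ext z; simp
    rw [this, add_comm]
    exact eLpNorm_sub_le ((hφ k).sub hG) ((hφ k).sub hF) (by norm_num)
  rw [eLpNorm_eq_zero_iff (hF.sub hG) two_ne_zero] at h3
  filter_upwards [h3] with x hx
  exact sub_eq_zero.1 hx

theorem tendsto_eLpNorm_l2Fourier {f : V → ℂ} {φ : ℕ → V → ℂ} (hf : MemLp f 2 volume)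
    (hφ : ∀ k, MemLp (φ k) 2 volume)
    (h : Tendsto (fun k => eLpNorm (fun z => φ k z - f z) 2 volume) atTop (𝓝 0)) :
    Tendsto (fun k => eLpNorm (fun z => l2Fourier (φ k) z - l2Fourier f z) 2 volume) atTop
      (𝓝 0) := by
  refine h.congr fun k => ?_
  have := eLpNorm_l2Fourier ((hφ k).sub hf)
  rw [eLpNorm_congr_ae (l2Fourier_sub (hφ k) hf)] at this
  exact this.symm

theorem tendsto_eLpNorm_fourier {f : V → ℂ} {φ : ℕ → V → ℂ} (hf : MemLp f 2 volume)
    (hφ : ∀ k, MemLp (φ k) 1 volume ∧ MemLp (φ k) 2 volume)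
    (h : Tendsto (fun k => eLpNorm (fun z => φ k z - f z) 2 volume) atTop (𝓝 0)) :
    Tendsto (fun k => eLpNorm (fun z => 𝓕 (φ k) z - l2Fourier f z) 2 volume) atTop (𝓝 0) := by
  refine (tendsto_eLpNorm_l2Fourier hf (fun k => (hφ k).2) h).congr fun k => ?_
  refine eLpNorm_congr_ae ?_
  filter_upwards [l2Fourier_ae_eq_fourier (hφ k).1 (hφ k).2] with x hx
  rw [hx]

theorem aestronglyMeasurable_fourier {h : V → ℂ} (h1 : MemLp h 1 volume)
    (h2 : MemLp h 2 volume) : AEStronglyMeasurable (𝓕 h) volume :=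
  (memLp_l2Fourier h).1.congr (l2Fourier_ae_eq_fourier h1 h2)

/-- The device by which identities for Fourier integrals on `L¹ ∩ L²` pass to `L²`: check the
formula on an approximating sequence and use uniqueness of limits. -/
theorem l2Fourier_ae_eq_of_tendsto {f F : V → ℂ} {φ : ℕ → V → ℂ} (hf : MemLp f 2 volume)
    (hF : AEStronglyMeasurable F volume)
    (hφ : ∀ k, MemLp (φ k) 1 volume ∧ MemLp (φ k) 2 volume)
    (h : Tendsto (fun k => eLpNorm (fun z => φ k z - f z) 2 volume) atTop (𝓝 0))
    (h' : Tendsto (fun k => eLpNorm (fun z => 𝓕 (φ k) z - F z) 2 volume) atTop (𝓝 0)) :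
    l2Fourier f =ᵐ[volume] F :=
  ae_eq_of_tendsto_eLpNorm (fun k => aestronglyMeasurable_fourier (hφ k).1 (hφ k).2)
    (memLp_l2Fourier f).1 hF (tendsto_eLpNorm_fourier hf hφ h) h'

/-! ### Composition with maps that multiply the measure by a constant. -/

section Scaling

variable {α W : Type*} [MeasurableSpace α] [NormedAddCommGroup W] {μ : Measure α} {T : α → α}
  {c : ℝ≥0∞} {f : α → W}

theorem aestronglyMeasurable_comp_of_map_eq_smul (hT : Measurable T) (hmap : μ.map T = c • μ)
    (hf : AEStronglyMeasurable f μ) : AEStronglyMeasurable (f ∘ T) μ :=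
  ((hf.smul_measure c).mono_measure hmap.le).comp_measurable hT

theorem eLpNorm_comp_of_map_eq_smul (hT : Measurable T) (hmap : μ.map T = c • μ)
    (hf : AEStronglyMeasurable f μ) :
    eLpNorm (f ∘ T) 2 μ = c ^ (1 / 2 : ℝ≥0∞).toReal * eLpNorm f 2 μ := by
  rw [← eLpNorm_map_measure ((hf.smul_measure c).mono_measure hmap.le) hT.aemeasurable, hmap,
    eLpNorm_smul_measure_of_ne_top (by norm_num), smul_eq_mul]

theorem memLp_comp_of_map_eq_smul {p : ℝ≥0∞} (hT : Measurable T) (hmap : μ.map T = c • μ)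
    (hc : c ≠ ∞) (hf : MemLp f p μ) : MemLp (f ∘ T) p μ := by
  refine MemLp.comp_of_map ?_ hT.aemeasurable
  rw [hmap]
  exact hf.smul_measure hc

theorem ae_comp_of_map_eq_smul {p : α → Prop} (hT : Measurable T) (hmap : μ.map T = c • μ)
    (hp : ∀ᵐ x ∂μ, p x) : ∀ᵐ x ∂μ, p (T x) := by
  refine ae_of_ae_map hT.aemeasurable ?_
  rw [hmap]
  exact Measure.ae_smul_measure hp c

theorem tendsto_eLpNorm_comp_of_map_eq_smul {φ : ℕ → α → W} (hT : Measurable T)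
    (hmap : μ.map T = c • μ) (hc : c ≠ ∞) (hφ : ∀ k, AEStronglyMeasurable (φ k) μ)
    (hf : AEStronglyMeasurable f μ)
    (h : Tendsto (fun k => eLpNorm (fun z => φ k z - f z) 2 μ) atTop (𝓝 0)) :
    Tendsto (fun k => eLpNorm (fun z => φ k (T z) - f (T z)) 2 μ) atTop (𝓝 0) := by
  have h' := ENNReal.Tendsto.const_mul (a := c ^ (1 / 2 : ℝ≥0∞).toReal) h
    (Or.inr (ENNReal.rpow_ne_top_of_nonneg ENNReal.toReal_nonneg hc))
  rw [mul_zero] at h'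
  exact h'.congr fun k => (eLpNorm_comp_of_map_eq_smul hT hmap ((hφ k).sub hf)).symm

end Scaling

/-! ### Affine changes of variable and correlations. -/

theorem map_continuousLinearEquiv_volume (B : V ≃L[ℝ] V) :
    (volume : Measure V).map B
      = ENNReal.ofReal |(LinearMap.det (B : V →ₗ[ℝ] V))⁻¹| • volume :=
  Measure.map_linearMap_addHaar_eq_smul_addHaar volume
    (LinearEquiv.isUnit_det' B.toLinearEquiv).ne_zero

theorem map_affine_volume (L : V ≃L[ℝ] V) (t : V) :
    (volume : Measure V).map (fun x => L.symm (x - t))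
      = ENNReal.ofReal |LinearMap.det (L : V →ₗ[ℝ] V)| • volume := by
  have h1 : (fun x => L.symm (x - t)) = L.symm ∘ (fun x => x - t) := rfl
  have h2 : LinearMap.det (L.symm : V →ₗ[ℝ] V) = (LinearMap.det (L : V →ₗ[ℝ] V))⁻¹ :=
    LinearEquiv.det_coe_symm L.toLinearEquiv
  rw [h1, ← Measure.map_map L.symm.continuous.measurable (by fun_prop),
    (measurePreserving_sub_right volume t).map_eq, map_continuousLinearEquiv_volume, h2, inv_inv]

theorem measurable_affine {U : Type*} [NormedAddCommGroup U] [NormedSpace ℝ U]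
    [MeasurableSpace U] [BorelSpace U] [SecondCountableTopology U] (L : U ≃L[ℝ] U) (t : U) : Measurable fun x => L.symm (x - t) :=
  L.symm.continuous.measurable.comp (by fun_prop)

theorem fourier_comp_affine (L B : V ≃L[ℝ] V) (hLB : ∀ y ξ, inner ℝ (L y) ξ = inner ℝ y (B ξ))
    (t : V) (h : V → ℂ) (ξ : V) :
    𝓕 (fun x => h (L.symm (x - t))) ξ =
      ((|LinearMap.det (L : V →ₗ[ℝ] V)| : ℝ) : ℂ) * ((𝐞 (-inner ℝ t ξ) : Circle) : ℂ) * 𝓕 h (B ξ) := by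
  have hT : MeasurableEmbedding (fun x => L.symm (x - t)) :=
    ((Homeomorph.subRight t).trans L.symm.toHomeomorph).measurableEmbedding
  have e1 : 𝓕 (fun x => h (L.symm (x - t))) ξ =
      ∫ x, (fun y => 𝐞 (-inner ℝ (L y + t) ξ) • h y) (L.symm (x - t)) := by
    rw [Real.fourier_eq]
    simp
  rw [e1, ← hT.integral_map (fun y => 𝐞 (-inner ℝ (L y + t) ξ) • h y), map_affine_volume, integral_smul_measure, Real.fourier_eq,
    ENNReal.toReal_ofReal (abs_nonneg _), ← integral_const_mul, ← integral_smul]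
  congr 1
  ext y
  simp only [Circle.smul_def, inner_add_left, hLB, neg_add, AddChar.map_add_eq_mul,
    Circle.coe_mul, smul_eq_mul, Complex.real_smul]
  ring

theorem l2Fourier_comp_affine (L B : V ≃L[ℝ] V)
    (hLB : ∀ y ξ, inner ℝ (L y) ξ = inner ℝ y (B ξ)) (t : V) {h : V → ℂ}
    (hh : MemLp h 2 volume) :
    l2Fourier (fun x => h (L.symm (x - t))) =ᵐ[volume] fun ξ =>
      ((|LinearMap.det (L : V →ₗ[ℝ] V)| : ℝ) : ℂ) * ((𝐞 (-inner ℝ t ξ) : Circle) : ℂ) * l2Fourier h (B ξ) := by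
  obtain ⟨φ, hφ, hφh⟩ := exists_tendsto_eLpNorm hh
  have hT := measurable_affine L t
  have hmap := map_affine_volume L t
  have hB := map_continuousLinearEquiv_volume B
  have hBm : Measurable B := B.continuous.measurable
  have hcont : Continuous fun ξ : V =>
      ((|LinearMap.det (L : V →ₗ[ℝ] V)| : ℝ) : ℂ) * ((𝐞 (-inner ℝ t ξ) : Circle) : ℂ) := by fun_prop
  refine l2Fourier_ae_eq_of_tendsto
    (memLp_comp_of_map_eq_smul hT hmap ENNReal.ofReal_ne_top hh)
    (hcont.aestronglyMeasurable.mul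
      (aestronglyMeasurable_comp_of_map_eq_smul hBm hB (memLp_l2Fourier h).1))
    (fun k => ⟨memLp_comp_of_map_eq_smul hT hmap ENNReal.ofReal_ne_top (hφ k).1,
      memLp_comp_of_map_eq_smul hT hmap ENNReal.ofReal_ne_top (hφ k).2⟩)
    (tendsto_eLpNorm_comp_of_map_eq_smul (T := fun x => L.symm (x - t)) hT hmap ENNReal.ofReal_ne_top
      (fun k => (hφ k).2.1) hh.1 hφh) ?_
  have h3 := tendsto_eLpNorm_comp_of_map_eq_smul hBm hB ENNReal.ofReal_ne_top
    (fun k => aestronglyMeasurable_fourier (hφ k).1 (hφ k).2) (memLp_l2Fourier h).1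
    (tendsto_eLpNorm_fourier hh hφ hφh)
  have h4 := ENNReal.Tendsto.const_mul (a := ‖|LinearMap.det (L : V →ₗ[ℝ] V)|‖ₑ) h3
    (Or.inr enorm_ne_top)
  rw [mul_zero] at h4
  refine h4.congr fun k => ?_
  rw [← eLpNorm_const_smul]
  refine eLpNorm_congr_norm_ae (Eventually.of_forall fun ξ => ?_)
  change _ = ‖𝓕 (fun x => φ k (L.symm (x - t))) ξ - _‖
  simp only [fourier_comp_affine L B hLB, ← mul_sub, Pi.smul_apply, norm_smul, norm_mul,
    Circle.norm_coe, Complex.norm_real, mul_one]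

theorem fourier_star_neg (h : V → ℂ) (ξ : V) : 𝓕 (fun x => star (h (-x))) ξ = star (𝓕 h ξ) := by
  rw [Real.fourier_eq, Real.fourier_eq, ← integral_neg_eq_self]
  simp only [Complex.star_def]
  rw [← integral_conj]
  congr 1
  ext x
  simp [Circle.smul_def, ← Circle.coe_inv_eq_conj, ← AddChar.map_neg_eq_inv]

theorem l2Fourier_star_neg {h : V → ℂ} (hh : MemLp h 2 volume) :
    l2Fourier (fun x => star (h (-x))) =ᵐ[volume] fun ξ => star (l2Fourier h ξ) := by
  obtain ⟨φ, hφ, hφh⟩ := exists_tendsto_eLpNorm hh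
  have hmp := Measure.measurePreserving_neg (volume : Measure V)
  have hstar : ∀ {p : ℝ≥0∞} {f : V → ℂ}, MemLp f p volume →
      MemLp (fun x => star (f (-x))) p volume := fun hf =>
    (hf.comp_measurePreserving hmp).star
  refine l2Fourier_ae_eq_of_tendsto (hstar hh) (memLp_l2Fourier h).star.1
    (fun k => ⟨hstar (hφ k).1, hstar (hφ k).2⟩) ?_ ?_
  · refine hφh.congr fun k => ?_
    refine (eLpNorm_comp_measurePreserving ((hφ k).2.1.sub hh.1) hmp).symm.trans ?_
    refine eLpNorm_congr_norm_ae (Eventually.of_forall fun x => ?_)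
    simp only [Function.comp_apply, ← star_sub, norm_star, Pi.sub_apply]
  · refine (tendsto_eLpNorm_fourier hh hφ hφh).congr fun k => ?_
    refine eLpNorm_congr_norm_ae (Eventually.of_forall fun x => ?_)
    simp only [fourier_star_neg, ← star_sub, norm_star]

/-- The correlation of `f` with the affine images of `g`, on the Fourier side. -/
theorem integral_mul_star_comp_affine (L B : V ≃L[ℝ] V)
    (hLB : ∀ y ξ, inner ℝ (L y) ξ = inner ℝ y (B ξ)) {f g : V → ℂ} (hf : MemLp f 2 volume)
    (hg : MemLp g 2 volume) (t : V) :
    ∫ x, f x * star (g (L.symm (x - t))) = |LinearMap.det (L : V →ₗ[ℝ] V)| *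
      𝓕⁻ (fun ξ => l2Fourier f ξ * star (l2Fourier g (B ξ))) t := by
  have hgt : MemLp (fun x => g (L.symm (x - t))) 2 volume :=
    memLp_comp_of_map_eq_smul (measurable_affine L t) (map_affine_volume L t)
      ENNReal.ofReal_ne_top hg
  rw [← integral_l2Fourier_mul_star hf hgt, Real.fourierInv_eq, ← integral_const_mul]
  refine integral_congr_ae ?_
  filter_upwards [l2Fourier_comp_affine L B hLB t hg] with ξ hξ
  rw [hξ]
  simp only [star_mul', Circle.smul_def, smul_eq_mul, Complex.star_def, Complex.conj_ofReal,
    ← Circle.coe_inv_eq_conj, ← AddChar.map_neg_eq_inv, neg_neg, real_inner_comm ξ t]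
  ring

/-- The correlation is `|det L|` times an inverse Fourier integral, so this is Plancherel. The
product on the frequency side is integrable by Cauchy–Schwarz; `hfin` says that it is also in `L²`.
-/
theorem lintegral_enorm_sq_correlation (L B : V ≃L[ℝ] V)
    (hLB : ∀ y ξ, inner ℝ (L y) ξ = inner ℝ y (B ξ)) {f g : V → ℂ} (hf : MemLp f 2 volume)
    (hg : MemLp g 2 volume)
    (hfin : ∫⁻ ξ, ‖l2Fourier f ξ‖ₑ ^ 2 * ‖l2Fourier g (B ξ)‖ₑ ^ 2 < ∞) :
    ∫⁻ t, ‖∫ x, f x * star (g (L.symm (x - t)))‖ₑ ^ 2 =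
      ENNReal.ofReal (LinearMap.det (L : V →ₗ[ℝ] V) ^ 2) *
        ∫⁻ ξ, ‖l2Fourier f ξ‖ₑ ^ 2 * ‖l2Fourier g (B ξ)‖ₑ ^ 2 := by
  set k : V → ℂ := fun ξ => l2Fourier f ξ * star (l2Fourier g (B ξ)) with hk
  have hgB : MemLp (fun ξ => star (l2Fourier g (B ξ))) 2 volume :=
    (memLp_comp_of_map_eq_smul B.continuous.measurable (map_continuousLinearEquiv_volume B)
      ENNReal.ofReal_ne_top (memLp_l2Fourier g)).star
  have hk1 : MemLp k 1 volume :=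
    memLp_one_iff_integrable.2 ((memLp_l2Fourier f).integrable_mul hgB)
  have hkn : ∀ ξ, ‖k ξ‖ₑ ^ 2 = ‖l2Fourier f ξ‖ₑ ^ 2 * ‖l2Fourier g (B ξ)‖ₑ ^ 2 := by
    intro ξ
    rw [hk, enorm_mul, mul_pow, ← ofReal_norm (star _), norm_star, ofReal_norm]
  have hk2 : MemLp k 2 volume := by
    refine ⟨hk1.1, ?_⟩
    have : eLpNorm k 2 volume ^ 2 < ∞ := by
      rw [eLpNorm_two_sq]; simpa only [hkn] using hfin
    exact lt_of_not_ge fun h => by simp [top_le_iff.1 h] at this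
  simp only [integral_mul_star_comp_affine L B hLB hf hg, enorm_mul, mul_pow, ← hkn]
  rw [lintegral_const_mul' _ _ (by simp), ← eLpNorm_two_sq, ← eLpNorm_two_sq, ← hk, eLpNorm_fourierInv hk1 hk2]
  congr 1
  rw [← ofReal_norm, ← ENNReal.ofReal_pow (norm_nonneg _)]
  simp

end Complex

/-! ### Quaternions as pairs of complex numbers -/

/-- The component `z` of `z + i w`, where `z` and `w` lie in the span of `1` and `j`. -/
def fstC : ℍ[ℝ] →L[ℝ] ℂ := LinearMap.toContinuousLinearMap
  { toFun := fun q => ⟨q.re, q.imJ⟩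
    map_add' := fun p q => by apply Complex.ext <;> simp
    map_smul' := fun r q => by apply Complex.ext <;> simp }

/-- The component `w` of `z + i w`, where `z` and `w` lie in the span of `1` and `j`. -/
def sndC : ℍ[ℝ] →L[ℝ] ℂ := LinearMap.toContinuousLinearMap
  { toFun := fun q => ⟨q.imI, q.imK⟩
    map_add' := fun p q => by apply Complex.ext <;> simp
    map_smul' := fun r q => by apply Complex.ext <;> simp }

/-- The quaternion `z + i w`, where the complex unit is sent to `j`. -/
def mkQ (z w : ℂ) : ℍ[ℝ] := ⟨z.re, w.re, z.im, w.im⟩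

@[simp] theorem fstC_re (q : ℍ[ℝ]) : (fstC q).re = q.re := rfl
@[simp] theorem fstC_im (q : ℍ[ℝ]) : (fstC q).im = q.imJ := rfl
@[simp] theorem sndC_re (q : ℍ[ℝ]) : (sndC q).re = q.imI := rfl
@[simp] theorem sndC_im (q : ℍ[ℝ]) : (sndC q).im = q.imK := rfl
@[simp] theorem mkQ_re (z w : ℂ) : (mkQ z w).re = z.re := rfl
@[simp] theorem mkQ_imI (z w : ℂ) : (mkQ z w).imI = w.re := rfl
@[simp] theorem mkQ_imJ (z w : ℂ) : (mkQ z w).imJ = z.im := rfl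
@[simp] theorem mkQ_imK (z w : ℂ) : (mkQ z w).imK = w.im := rfl
@[simp] theorem fstC_mkQ (z w : ℂ) : fstC (mkQ z w) = z := rfl
@[simp] theorem sndC_mkQ (z w : ℂ) : sndC (mkQ z w) = w := rfl
@[simp] theorem mkQ_fstC_sndC (q : ℍ[ℝ]) : mkQ (fstC q) (sndC q) = q := rfl

theorem ext_fstC_sndC {p q : ℍ[ℝ]} (h1 : fstC p = fstC q) (h2 : sndC p = sndC q) : p = q := by
  rw [← mkQ_fstC_sndC p, h1, h2, mkQ_fstC_sndC]

theorem norm_sq_eq_fstC_sndC (q : ℍ[ℝ]) : ‖q‖ ^ 2 = ‖fstC q‖ ^ 2 + ‖sndC q‖ ^ 2 := by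
  rw [sq, ← Quaternion.normSq_eq_norm_mul_self, Quaternion.normSq_def', Complex.sq_norm,
    Complex.sq_norm, Complex.normSq_apply, Complex.normSq_apply]
  simp only [fstC_re, fstC_im, sndC_re, sndC_im]
  ring

theorem enorm_sq_eq_fstC_sndC (q : ℍ[ℝ]) : ‖q‖ₑ ^ 2 = ‖fstC q‖ₑ ^ 2 + ‖sndC q‖ₑ ^ 2 := by
  simp only [← ofReal_norm, ← ENNReal.ofReal_pow (norm_nonneg _)]
  rw [norm_sq_eq_fstC_sndC, ENNReal.ofReal_add (by positivity) (by positivity)]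

theorem norm_fstC_le (q : ℍ[ℝ]) : ‖fstC q‖ ≤ ‖q‖ := by
  refine le_of_sq_le_sq ?_ (norm_nonneg _)
  rw [norm_sq_eq_fstC_sndC]; nlinarith [sq_nonneg ‖sndC q‖]

theorem norm_sndC_le (q : ℍ[ℝ]) : ‖sndC q‖ ≤ ‖q‖ := by
  refine le_of_sq_le_sq ?_ (norm_nonneg _)
  rw [norm_sq_eq_fstC_sndC]; nlinarith [sq_nonneg ‖fstC q‖]

theorem norm_mkQ_le (z w : ℂ) : ‖mkQ z w‖ ≤ ‖z‖ + ‖w‖ := by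
  refine le_of_sq_le_sq ?_ (by positivity)
  rw [norm_sq_eq_fstC_sndC, fstC_mkQ, sndC_mkQ]
  nlinarith [norm_nonneg z, norm_nonneg w]

theorem continuous_mkQ : Continuous fun p : ℂ × ℂ => mkQ p.1 p.2 := by
  let T : ℂ × ℂ →ₗ[ℝ] ℍ[ℝ] :=
    { toFun := fun p => mkQ p.1 p.2
      map_add' := fun p q => by ext <;> simp
      map_smul' := fun r q => by ext <;> simp }
  exact (LinearMap.toContinuousLinearMap T).continuous

@[simp] theorem fstC_qi : fstC qi = 0 := rfl
@[simp] theorem sndC_qi : sndC qi = 1 := rfl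
@[simp] theorem fstC_qj : fstC qj = Complex.I := rfl
@[simp] theorem sndC_qj : sndC qj = 0 := rfl

theorem exp_smul_of_norm_eq_one {u : ℍ[ℝ]} (hu : u.re = 0) (hn : ‖u‖ = 1) (t : ℝ) :
    NormedSpace.exp (t • u) = (Real.cos t : ℍ[ℝ]) + Real.sin t • u := by
  rw [Quaternion.exp_of_re_eq_zero _ (by simp [hu]), norm_smul, hn, mul_one, Real.norm_eq_abs,
    Real.cos_abs, smul_smul]
  congr 2
  -- The quotient `sin |t| / |t|` is even, so multiplying it by `t` gives `sin t`; at `t = 0` both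
  -- sides vanish.
  rcases eq_or_ne t 0 with rfl | ht
  · simp
  · rcases abs_cases t with ⟨h, _⟩ | ⟨h, _⟩ <;> rw [h] <;> simp [ht]

theorem norm_qi : ‖qi‖ = 1 := by
  rw [← pow_eq_one_iff_of_nonneg (norm_nonneg _) two_ne_zero, norm_sq_eq_fstC_sndC]
  simp

theorem norm_qj : ‖qj‖ = 1 := by
  rw [← pow_eq_one_iff_of_nonneg (norm_nonneg _) two_ne_zero, norm_sq_eq_fstC_sndC]
  simp

theorem exp_smul_qi (t : ℝ) : NormedSpace.exp (t • qi) = mkQ (Real.cos t) (Real.sin t) := by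
  rw [exp_smul_of_norm_eq_one rfl norm_qi]
  apply ext_fstC_sndC
  · rw [map_add, map_smul, fstC_qi, fstC_mkQ, smul_zero, add_zero]
    apply Complex.ext <;> simp [-Complex.ofReal_cos, -Complex.ofReal_sin]
  · rw [map_add, map_smul, sndC_qi, sndC_mkQ]
    apply Complex.ext <;> simp [-Complex.ofReal_cos, -Complex.ofReal_sin]

theorem exp_smul_qj (t : ℝ) :
    NormedSpace.exp (t • qj) = mkQ (Complex.exp (t * Complex.I)) 0 := by
  rw [exp_smul_of_norm_eq_one rfl norm_qj, Complex.exp_mul_I]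
  apply ext_fstC_sndC
  · rw [map_add, map_smul, fstC_qj, fstC_mkQ]
    apply Complex.ext <;> simp [← Complex.ofReal_cos, ← Complex.ofReal_sin]
  · rw [map_add, map_smul, sndC_qj, sndC_mkQ]
    apply Complex.ext <;> simp

/-- The quaternion obtained from the values `z`, `w` at a point and the values `z'`, `w'` at its
reflection. -/
def twoSided (z z' w w' : ℂ) : ℍ[ℝ] :=
  mkQ ((z + z') / 2 + Complex.I / 2 * (w - w')) ((w + w') / 2 - Complex.I / 2 * (z - z'))

/-- Left multiplication by `e^{-ia}` sends `(z, w)` to `(cos a · z + sin a · w, cos a · w - sin a ·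
z)`, and right multiplication by `e^{-jb}` multiplies both components by `e^{-Ib}`. Expanding `cos
a` and `sin a` in exponentials leaves the phases `a + b` and `-a + b`. -/
theorem exp_mul_mul_exp (a b : ℝ) (q : ℍ[ℝ]) :
    NormedSpace.exp ((-a) • qi) * q * NormedSpace.exp ((-b) • qj) =
      twoSided (Complex.exp (-(a + b : ℝ) * Complex.I) * fstC q)
        (Complex.exp (-(-a + b : ℝ) * Complex.I) * fstC q)
        (Complex.exp (-(a + b : ℝ) * Complex.I) * sndC q)
        (Complex.exp (-(-a + b : ℝ) * Complex.I) * sndC q) := by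
  have h1 : ∀ t : ℝ, Complex.exp (-(t : ℝ) * Complex.I) = ⟨Real.cos t, -Real.sin t⟩ := by
    intro t
    rw [← Complex.ofReal_neg, Complex.exp_mul_I]
    apply Complex.ext <;> simp [← Complex.ofReal_cos, ← Complex.ofReal_sin]
  rw [exp_smul_qi, exp_smul_qj, Complex.ofReal_neg, h1, h1, h1, twoSided]
  have hI : Complex.I / 2 = ⟨0, 1 / 2⟩ := by apply Complex.ext <;> simp
  simp only [hI, Real.cos_neg, Real.sin_neg, Real.cos_add, Real.sin_add]
  ext <;> simp [-Complex.ofReal_cos, -Complex.ofReal_sin] <;> ring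

variable {n : ℕ}

/-! ### The quaternion Fourier transform in terms of the complex one -/

theorem twoSided_sub (z z' w w' y y' x x' : ℂ) :
    twoSided z z' w w' - twoSided y y' x x' =
      twoSided (z - y) (z' - y') (w - x) (w' - x') := by
  apply ext_fstC_sndC
  · rw [map_sub]; simp only [twoSided, fstC_mkQ]; ring
  · rw [map_sub]; simp only [twoSided, sndC_mkQ]; ring

theorem norm_twoSided_le (z z' w w' : ℂ) :
    ‖twoSided z z' w w'‖ ≤ ‖z‖ + ‖z'‖ + (‖w‖ + ‖w'‖) := by
  have h : ∀ a b c d : ℂ, ‖(a + b) / 2 + Complex.I / 2 * (c - d)‖ ≤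
      (‖a‖ + ‖b‖) / 2 + (‖c‖ + ‖d‖) / 2 := by
    intro a b c d
    refine (norm_add_le _ _).trans (add_le_add ?_ ?_)
    · rw [norm_div, Complex.norm_two]
      gcongr
      exact norm_add_le _ _
    · rw [norm_mul, norm_div, Complex.norm_two, Complex.norm_I, div_mul_eq_mul_div, one_mul]
      gcongr
      exact norm_sub_le _ _
  refine (norm_mkQ_le _ _).trans ?_
  have h1 := h z z' w w'
  have h2 := h w w' (-z) (-z')
  rw [norm_neg, norm_neg, show -z - -z' = -(z - z') by ring, mul_neg, ← sub_eq_add_neg] at h2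
  linarith

theorem continuous_twoSided :
    Continuous fun p : ℂ × ℂ × ℂ × ℂ => twoSided p.1 p.2.1 p.2.2.1 p.2.2.2 :=
  continuous_mkQ.comp (by fun_prop : Continuous fun p : ℂ × ℂ × ℂ × ℂ =>
    (((p.1 + p.2.1) / 2 + Complex.I / 2 * (p.2.2.1 - p.2.2.2),
      (p.2.2.1 + p.2.2.2) / 2 - Complex.I / 2 * (p.1 - p.2.1)) : ℂ × ℂ))

theorem aestronglyMeasurable_twoSided {α : Type*} [MeasurableSpace α] {μ : Measure α}
    {z z' w w' : α → ℂ} (hz : AEStronglyMeasurable z μ) (hz' : AEStronglyMeasurable z' μ)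
    (hw : AEStronglyMeasurable w μ) (hw' : AEStronglyMeasurable w' μ) :
    AEStronglyMeasurable (fun a => twoSided (z a) (z' a) (w a) (w' a)) μ :=
  Continuous.comp_aestronglyMeasurable (f := fun a => (z a, z' a, w a, w' a))
    (g := fun p : ℂ × ℂ × ℂ × ℂ => twoSided p.1 p.2.1 p.2.2.1 p.2.2.2) continuous_twoSided
    (hz.prodMk (hz'.prodMk (hw.prodMk hw')))

/-- The components are `(z + z')/2` and `-I(z - z')/2`, so this is the parallelogram law. -/
theorem enorm_sq_twoSided_zero (z z' : ℂ) :
    ‖twoSided z z' 0 0‖ₑ ^ 2 = (‖z‖ₑ ^ 2 + ‖z'‖ₑ ^ 2) / 2 := by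
  have h : ‖twoSided z z' 0 0‖ ^ 2 = (‖z‖ ^ 2 + ‖z'‖ ^ 2) / 2 := by
    rw [norm_sq_eq_fstC_sndC, twoSided, fstC_mkQ, sndC_mkQ]
    simp only [Complex.sq_norm, Complex.normSq_apply, sub_zero, add_zero, mul_zero, zero_div,
      zero_sub]
    simp
    ring
  simp only [← ofReal_norm, ← ENNReal.ofReal_pow (norm_nonneg _)]
  rw [h, ENNReal.ofReal_div_of_pos two_pos, ENNReal.ofReal_add (by positivity) (by positivity)]
  simp

/-- The reflection `(u, v) ↦ (-u, v)`. -/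
def reflFst (n : ℕ) : E n ≃ₗᵢ[ℝ] E n :=
  LinearIsometryEquiv.piLpCongrRight 2 fun k : Fin (2 * n) =>
    if k.val < n then LinearIsometryEquiv.neg ℝ else LinearIsometryEquiv.refl ℝ ℝ

theorem reflFst_apply (ξ : E n) (k : Fin (2 * n)) :
    reflFst n ξ k = if k.val < n then -ξ k else ξ k := by
  rw [reflFst, LinearIsometryEquiv.piLpCongrRight_apply]
  split_ifs <;> simp [*]

theorem sum_fin_two_mul (F : Fin (2 * n) → ℝ) :
    ∑ k, F k = ∑ p : Fin n, F ⟨p.val, by omega⟩ + ∑ p : Fin n, F ⟨n + p.val, by omega⟩ := by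
  have h : ∀ (N : ℕ) (hN : N = n + n) (F : Fin N → ℝ),
      ∑ k, F k = ∑ p : Fin n, F ⟨p.val, by omega⟩ + ∑ p : Fin n, F ⟨n + p.val, by omega⟩ := by
    intro N hN F
    subst hN
    exact Fin.sum_univ_add F
  exact h _ (two_mul n) F

theorem inner_eq_dotFst_add_dotSnd (z ξ : E n) : inner ℝ z ξ = dotFst ξ z + dotSnd ξ z := by
  rw [PiLp.inner_apply, sum_fin_two_mul]
  rfl

theorem inner_reflFst (z ξ : E n) : inner ℝ z (reflFst n ξ) = -dotFst ξ z + dotSnd ξ z := by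
  rw [inner_eq_dotFst_add_dotSnd]
  simp [dotFst, dotSnd, reflFst_apply]

theorem measurePreserving_reflFst : MeasurePreserving (reflFst n) volume volume :=
  (reflFst n).measurePreserving

/-- The quaternion-valued function on the Fourier side that corresponds to the two complex
functions `G`, `H`. -/
def twoSidedFun (G H : E n → ℂ) (ξ : E n) : ℍ[ℝ] :=
  twoSided (G ξ) (G (reflFst n ξ)) (H ξ) (H (reflFst n ξ))

theorem fourier_eq_integral_exp (h : E n → ℂ) (ξ : E n) :
    𝓕 h ξ = ∫ z, Complex.exp (-(2 * Real.pi * inner ℝ z ξ : ℝ) * Complex.I) * h z := by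
  rw [Real.fourier_eq']
  congr 1
  ext z
  rw [smul_eq_mul]
  push_cast
  ring_nf

theorem integrable_exp_mul {h : E n → ℂ} (hh : Integrable h) (ξ : E n) :
    Integrable fun z => Complex.exp (-(2 * Real.pi * inner ℝ z ξ : ℝ) * Complex.I) * h z := by
  refine hh.bdd_mul (c := 1) (Continuous.aestronglyMeasurable (by fun_prop))
    (Eventually.of_forall fun z => ?_)
  rw [← Complex.ofReal_neg, Complex.norm_exp_ofReal_mul_I]

theorem integral_half_add_mul_sub {α : Type*} [MeasurableSpace α] {μ : Measure α}
    {A A' B B' : α → ℂ} (hA : Integrable A μ) (hA' : Integrable A' μ) (hB : Integrable B μ)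
    (hB' : Integrable B' μ) (c : ℂ) :
    ∫ z, ((A z + A' z) / 2 + c * (B z - B' z)) ∂μ =
      (∫ z, A z ∂μ + ∫ z, A' z ∂μ) / 2 + c * (∫ z, B z ∂μ - ∫ z, B' z ∂μ) := by
  rw [← integral_add hA hA', ← integral_sub hB hB', ← integral_const_mul, ← integral_div]
  exact integral_add ((hA.add hA').div_const 2) ((hB.sub hB').const_mul c)

/-- The phases `2π(u·x + v·y)` and `2π(-u·x + v·y)` are those of ordinary Fourier integrals at `ξ`
and at its reflection. -/
theorem qftIntegral_eq {φ : E n → ℍ[ℝ]} (hφ : Integrable φ) :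
    qftIntegral φ = twoSidedFun (𝓕 fun z => fstC (φ z)) (𝓕 fun z => sndC (φ z)) := by
  ext1 ξ
  have h1 : ∀ ξ, Integrable fun z =>
      Complex.exp (-(2 * Real.pi * inner ℝ z ξ : ℝ) * Complex.I) * fstC (φ z) :=
    fun ξ => integrable_exp_mul (fstC.integrable_comp hφ) ξ
  have h2 : ∀ ξ, Integrable fun z =>
      Complex.exp (-(2 * Real.pi * inner ℝ z ξ : ℝ) * Complex.I) * sndC (φ z) :=
    fun ξ => integrable_exp_mul (sndC.integrable_comp hφ) ξ
  have hint : ∀ z, NormedSpace.exp ((-(2 * Real.pi * dotFst ξ z)) • qi) * φ z *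
      NormedSpace.exp ((-(2 * Real.pi * dotSnd ξ z)) • qj) =
      twoSided (Complex.exp (-(2 * Real.pi * inner ℝ z ξ : ℝ) * Complex.I) * fstC (φ z))
        (Complex.exp (-(2 * Real.pi * inner ℝ z (reflFst n ξ) : ℝ) * Complex.I) * fstC (φ z))
        (Complex.exp (-(2 * Real.pi * inner ℝ z ξ : ℝ) * Complex.I) * sndC (φ z))
        (Complex.exp (-(2 * Real.pi * inner ℝ z (reflFst n ξ) : ℝ) * Complex.I) *
          sndC (φ z)) := by
    intro z
    rw [exp_mul_mul_exp, inner_eq_dotFst_add_dotSnd, inner_reflFst]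
    congr 4 <;> ring_nf
  have hI : Integrable fun z => NormedSpace.exp ((-(2 * Real.pi * dotFst ξ z)) • qi) * φ z *
      NormedSpace.exp ((-(2 * Real.pi * dotSnd ξ z)) • qj) := by
    simp only [hint]
    refine (((h1 ξ).norm.add (h1 (reflFst n ξ)).norm).add
      ((h2 ξ).norm.add (h2 (reflFst n ξ)).norm)).mono' ?_
      (Eventually.of_forall fun z => norm_twoSided_le _ _ _ _)
    exact aestronglyMeasurable_twoSided (h1 ξ).1 (h1 (reflFst n ξ)).1 (h2 ξ).1
      (h2 (reflFst n ξ)).1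
  apply ext_fstC_sndC
  · rw [qftIntegral, ← fstC.integral_comp_comm hI]
    simp only [hint, twoSided, fstC_mkQ, twoSidedFun, fourier_eq_integral_exp]
    exact integral_half_add_mul_sub (h1 _) (h1 _) (h2 _) (h2 _) _
  · rw [qftIntegral, ← sndC.integral_comp_comm hI]
    -- The second component carries a minus sign; it is absorbed into the constant `-I/2` so that
    -- `integral_half_add_mul_sub` applies again.
    simp only [hint, twoSided, sndC_mkQ, twoSidedFun, fourier_eq_integral_exp, sub_eq_add_neg,
      ← neg_mul (Complex.I / 2)]
    simp only [← sub_eq_add_neg]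
    exact integral_half_add_mul_sub (h2 _) (h2 _) (h1 _) (h1 _) _

theorem aestronglyMeasurable_twoSidedFun {G H : E n → ℂ} (hG : AEStronglyMeasurable G volume)
    (hH : AEStronglyMeasurable H volume) : AEStronglyMeasurable (twoSidedFun G H) volume :=
  aestronglyMeasurable_twoSided hG (hG.comp_measurePreserving measurePreserving_reflFst) hH
    (hH.comp_measurePreserving measurePreserving_reflFst)

/-- A crude constant suffices: only `L²` continuity of the passage from complex to quaternion
transforms is needed. -/
theorem eLpNorm_twoSidedFun_le {G H : E n → ℂ} (hG : AEStronglyMeasurable G volume)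
    (hH : AEStronglyMeasurable H volume) :
    eLpNorm (twoSidedFun G H) 2 volume ≤
      eLpNorm G 2 volume + eLpNorm G 2 volume + (eLpNorm H 2 volume + eLpNorm H 2 volume) := by
  have hR := measurePreserving_reflFst (n := n)
  have hG' := hG.comp_measurePreserving hR
  have hH' := hH.comp_measurePreserving hR
  have h1 : eLpNorm (twoSidedFun G H) 2 volume ≤ eLpNorm
      (((fun ξ => ‖G ξ‖) + fun ξ => ‖(G ∘ reflFst n) ξ‖) +
        ((fun ξ => ‖H ξ‖) + fun ξ => ‖(H ∘ reflFst n) ξ‖)) 2 volume :=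
    eLpNorm_mono_real fun ξ => norm_twoSided_le _ _ _ _
  refine h1.trans ((eLpNorm_add_le (hG.norm.add hG'.norm) (hH.norm.add hH'.norm)
    one_le_two).trans ?_)
  refine add_le_add ((eLpNorm_add_le hG.norm hG'.norm one_le_two).trans ?_)
    ((eLpNorm_add_le hH.norm hH'.norm one_le_two).trans ?_)
  · rw [eLpNorm_norm, eLpNorm_norm, eLpNorm_comp_measurePreserving hG hR]
  · rw [eLpNorm_norm, eLpNorm_norm, eLpNorm_comp_measurePreserving hH hR]

theorem memLp_fstC {p : ℝ≥0∞} {f : E n → ℍ[ℝ]} (hf : MemLp f p volume) :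
    MemLp (fun z => fstC (f z)) p volume := fstC.comp_memLp' hf

theorem memLp_sndC {p : ℝ≥0∞} {f : E n → ℍ[ℝ]} (hf : MemLp f p volume) :
    MemLp (fun z => sndC (f z)) p volume := sndC.comp_memLp' hf

/-- The quaternion Fourier transform of `f ∈ L²`, in terms of the complex Fourier transform. -/
def qftL2 (f : E n → ℍ[ℝ]) : E n → ℍ[ℝ] :=
  twoSidedFun (l2Fourier fun z => fstC (f z)) (l2Fourier fun z => sndC (f z))

theorem memLp_qftL2 (f : E n → ℍ[ℝ]) : MemLp (qftL2 f) 2 volume := by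
  have h1 := memLp_l2Fourier fun z => fstC (f z)
  have h2 := memLp_l2Fourier fun z => sndC (f z)
  refine ⟨aestronglyMeasurable_twoSidedFun h1.1 h2.1, ?_⟩
  refine (eLpNorm_twoSidedFun_le h1.1 h2.1).trans_lt ?_
  simp [ENNReal.add_lt_top, h1.2, h2.2]

theorem tendsto_qftIntegral {f : E n → ℍ[ℝ]} (hf : MemLp f 2 volume) {φ : ℕ → E n → ℍ[ℝ]}
    (hφ : ∀ k, MemLp (φ k) 1 volume ∧ MemLp (φ k) 2 volume)
    (h : Tendsto (fun k => eLpNorm (fun z => φ k z - f z) 2 volume) atTop (𝓝 0)) :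
    Tendsto (fun k => eLpNorm (fun ξ => qftIntegral (φ k) ξ - qftL2 f ξ) 2 volume) atTop
      (𝓝 0) := by
  have h1 : Tendsto (fun k => eLpNorm (fun z => fstC (φ k z) - fstC (f z)) 2 volume) atTop
      (𝓝 0) := by
    refine tendsto_of_tendsto_of_tendsto_of_le_of_le tendsto_const_nhds h (fun _ => zero_le)
      fun k => eLpNorm_mono fun z => ?_
    rw [← map_sub]; exact norm_fstC_le _
  have h2 : Tendsto (fun k => eLpNorm (fun z => sndC (φ k z) - sndC (f z)) 2 volume) atTop
      (𝓝 0) := by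
    refine tendsto_of_tendsto_of_tendsto_of_le_of_le tendsto_const_nhds h (fun _ => zero_le)
      fun k => eLpNorm_mono fun z => ?_
    rw [← map_sub]; exact norm_sndC_le _
  have h1' := tendsto_eLpNorm_fourier (memLp_fstC hf)
    (fun k => ⟨memLp_fstC (hφ k).1, memLp_fstC (hφ k).2⟩) h1
  have h2' := tendsto_eLpNorm_fourier (memLp_sndC hf)
    (fun k => ⟨memLp_sndC (hφ k).1, memLp_sndC (hφ k).2⟩) h2
  have h3 := (h1'.add h1').add (h2'.add h2')
  simp only [add_zero] at h3
  refine tendsto_of_tendsto_of_tendsto_of_le_of_le tendsto_const_nhds h3 (fun _ => zero_le)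
    fun k => ?_
  have e : (fun ξ => qftIntegral (φ k) ξ - qftL2 f ξ) = twoSidedFun
      (fun ξ => 𝓕 (fun z => fstC (φ k z)) ξ - l2Fourier (fun z => fstC (f z)) ξ)
      (fun ξ => 𝓕 (fun z => sndC (φ k z)) ξ - l2Fourier (fun z => sndC (f z)) ξ) := by
    ext1 ξ
    rw [qftIntegral_eq (memLp_one_iff_integrable.1 (hφ k).1)]
    exact twoSided_sub _ _ _ _ _ _ _ _
  simp only [e]
  exact eLpNorm_twoSidedFun_le
    ((aestronglyMeasurable_fourier (memLp_fstC (hφ k).1) (memLp_fstC (hφ k).2)).sub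
      (memLp_l2Fourier _).1)
    ((aestronglyMeasurable_fourier (memLp_sndC (hφ k).1) (memLp_sndC (hφ k).2)).sub
      (memLp_l2Fourier _).1)

theorem isQFT_qftL2 {f : E n → ℍ[ℝ]} (hf : MemLp f 2 volume) : IsQFT f (qftL2 f) := by
  obtain ⟨φ, hφ, hφf⟩ := exists_tendsto_eLpNorm hf
  exact ⟨memLp_qftL2 f, φ, hφ, hφf, tendsto_qftIntegral hf hφ hφf⟩

/-- The transform `qft` is an arbitrary choice among functions satisfying `IsQFT`; this shows that
the choice is immaterial up to a null set. -/
theorem IsQFT.ae_eq {f F : E n → ℍ[ℝ]} (hf : MemLp f 2 volume) (h : IsQFT f F) :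
    F =ᵐ[volume] qftL2 f := by
  obtain ⟨hF, φ, hφ, hφf, hφF⟩ := h
  refine ae_eq_of_tendsto_eLpNorm (fun k => ?_) hF.1 (memLp_qftL2 f).1 hφF
    (tendsto_qftIntegral hf hφ hφf)
  rw [qftIntegral_eq (memLp_one_iff_integrable.1 (hφ k).1)]
  exact aestronglyMeasurable_twoSidedFun
    (aestronglyMeasurable_fourier (memLp_fstC (hφ k).1) (memLp_fstC (hφ k).2))
    (aestronglyMeasurable_fourier (memLp_sndC (hφ k).1) (memLp_sndC (hφ k).2))

theorem qft_ae_eq {f : E n → ℍ[ℝ]} (hf : MemLp f 2 volume) : qft f =ᵐ[volume] qftL2 f := by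
  have h : ∃ F, IsQFT f F := ⟨_, isQFT_qftL2 hf⟩
  rw [qft, dif_pos h]
  exact IsQFT.ae_eq hf h.choose_spec

/-! ### Consequences of the commutation hypothesis -/

theorem ae_apply_ne_zero {ι : Type*} [Fintype ι] [DecidableEq ι] (k : ι) :
    ∀ᵐ ξ : EuclideanSpace ℝ ι, ξ k ≠ 0 := by
  have h : (volume : Measure (EuclideanSpace ℝ ι))
      (LinearMap.ker (EuclideanSpace.proj k : EuclideanSpace ℝ ι →L[ℝ] ℝ).toLinearMap) = 0 := by
    apply Measure.addHaar_submodule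
    intro htop
    have h1 : EuclideanSpace.single k (1 : ℝ) ∈
        LinearMap.ker (EuclideanSpace.proj k : EuclideanSpace ℝ ι →L[ℝ] ℝ).toLinearMap := by
      rw [htop]; trivial
    simp at h1
  rw [ae_iff]
  simp only [not_not]
  exact h

@[simp] theorem qj_re : qj.re = 0 := rfl
@[simp] theorem qj_imI : qj.imI = 0 := rfl
@[simp] theorem qj_imJ : qj.imJ = 1 := rfl
@[simp] theorem qj_imK : qj.imK = 0 := rfl

theorem sndC_eq_zero_of_commute {q : ℍ[ℝ]} (h : q * qj = qj * q) : sndC q = 0 := by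
  have h1 := congrArg (fun x : ℍ[ℝ] => x.imI) h
  have h2 := congrArg (fun x : ℍ[ℝ] => x.imK) h
  simp only [Quaternion.imI_mul, Quaternion.imK_mul] at h1 h2
  simp only [qj_re, qj_imI, qj_imJ, qj_imK] at h1 h2
  apply Complex.ext
  · simp only [sndC_re, Complex.zero_re]; linarith
  · simp only [sndC_im, Complex.zero_im]; linarith

/-- Almost everywhere `F_Q(g)` commutes with `j`, and `F_Q(jg) = j F_Q(g)`. -/
theorem CommutationHyp.ae_commute [NeZero n] {g : E n → ℍ[ℝ]} (h : CommutationHyp g) :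
    ∀ᵐ ξ, qft g ξ * qj = qj * qft g ξ ∧ qft (fun z => qj * g z) ξ = qj * qft g ξ := by
  have hn := NeZero.pos n
  filter_upwards [h, ae_apply_ne_zero (⟨n, by omega⟩ : Fin (2 * n))] with ξ hξ hξ0
  constructor
  · have h1 := (hξ (EuclideanSpace.single ⟨0, hn⟩ (-(4 * ξ ⟨n, by omega⟩)⁻¹))).1
    have h2 : NormedSpace.exp ((-(2 * Real.pi * ∑ p : Fin n, ξ ⟨n + p.val, by omega⟩ *
        EuclideanSpace.single (⟨0, hn⟩ : Fin n) (-(4 * ξ ⟨n, by omega⟩)⁻¹) p)) • qj) = qj := by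
      rw [Finset.sum_eq_single ⟨0, hn⟩
        (fun p _ hp => by rw [PiLp.single_apply, if_neg hp, mul_zero]) (by simp),
        exp_smul_qj]
      have h3 : -(2 * Real.pi * (ξ ⟨n + 0, by omega⟩ *
          EuclideanSpace.single (⟨0, hn⟩ : Fin n) (-(4 * ξ ⟨n, by omega⟩)⁻¹) ⟨0, hn⟩)) =
          Real.pi / 2 := by
        simp
        field_simp
        norm_num
      rw [h3]
      push_cast
      rw [Complex.exp_pi_div_two_mul_I]
      exact ext_fstC_sndC rfl rfl
    simp only [h2] at h1
    exact h1
  -- At `t = 0` the exponential is `1`.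
  · have := (hξ 0).2
    simpa using this

theorem fstC_qj_mul (q : ℍ[ℝ]) : fstC (qj * q) = Complex.I * fstC q := by
  apply Complex.ext
  · simp [Quaternion.re_mul]
  · simp [Quaternion.imJ_mul]

theorem sndC_qj_mul (q : ℍ[ℝ]) : sndC (qj * q) = -Complex.I * sndC q := by
  apply Complex.ext
  · simp [Quaternion.imI_mul]
  · simp [Quaternion.imK_mul]

theorem fstC_star (q : ℍ[ℝ]) : fstC (star q) = star (fstC q) := by
  apply Complex.ext <;> simp

theorem sndC_star (q : ℍ[ℝ]) : sndC (star q) = -sndC q := by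
  apply Complex.ext <;> simp

theorem memLp_qj_mul {g : E n → ℍ[ℝ]} (hg : MemLp g 2 volume) :
    MemLp (fun z => qj * g z) 2 volume :=
  hg.const_mul qj

theorem reflFst_reflFst (ξ : E n) : reflFst n (reflFst n ξ) = ξ := by
  ext k
  simp only [reflFst_apply]
  split_ifs <;> simp

/-- A function in `L²` that satisfies the commutation hypothesis takes values in the span of `1`
and `j`. -/
theorem CommutationHyp.sndC_ae_eq_zero [NeZero n] {g : E n → ℍ[ℝ]} (hg : MemLp g 2 volume)
    (h : CommutationHyp g) : (fun z => sndC (g z)) =ᵐ[volume] 0 := by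
  apply ae_eq_zero_of_l2Fourier (memLp_sndC hg)
  set G := l2Fourier fun z => fstC (g z) with hG
  set H := l2Fourier fun z => sndC (g z) with hH
  have e1 : (fun z => fstC (qj * g z)) = Complex.I • fun z => fstC (g z) := by
    ext1 z; exact fstC_qj_mul _
  have e2 : (fun z => sndC (qj * g z)) = (-Complex.I) • fun z => sndC (g z) := by
    ext1 z; exact sndC_qj_mul _
  have hR : ∀ {p : E n → Prop}, (∀ᵐ ξ, p ξ) → ∀ᵐ ξ, p (reflFst n ξ) := fun hp =>
    measurePreserving_reflFst.quasiMeasurePreserving.ae hp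
  have hj1 : ∀ᵐ ξ, l2Fourier (fun z => fstC (qj * g z)) ξ = Complex.I * G ξ := by
    rw [e1]; exact l2Fourier_const_smul _ (memLp_fstC hg)
  have hj2 : ∀ᵐ ξ, l2Fourier (fun z => sndC (qj * g z)) ξ = -Complex.I * H ξ := by
    rw [e2]; exact l2Fourier_const_smul _ (memLp_sndC hg)
  have hmain : ∀ᵐ ξ, sndC (qftL2 g ξ) = 0 ∧ qftL2 (fun z => qj * g z) ξ = qj * qftL2 g ξ := by
    filter_upwards [h.ae_commute, qft_ae_eq hg, qft_ae_eq (memLp_qj_mul hg)] with ξ h1 h2 h3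
    rw [← h2, ← h3]
    exact ⟨sndC_eq_zero_of_commute h1.1, h1.2⟩
  filter_upwards [hmain, hR hmain, hj1, hj2, hR hj1, hR hj2] with ξ m1 m2 a1 a2 b1 b2
  have c1 := m1.1
  have c2 := m2.1
  have c3 := congrArg fstC m1.2
  rw [fstC_qj_mul] at c3
  simp only [qftL2, twoSidedFun, twoSided, fstC_mkQ, sndC_mkQ, reflFst_reflFst, a1, a2, b1, b2,
    ← hG, ← hH] at c1 c2 c3
  have hI := Complex.I_mul_I
  -- The term in `G` is odd under the reflection, so vanishing of the second component at both
  -- points kills the even part of `H`. Left multiplication by `j` acts as `I` on first and `-I` on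
  -- second components, so `F_Q(jg) = j F_Q(g)` kills the odd part.
  have s1 : H ξ + H (reflFst n ξ) = 0 := by linear_combination c1 + c2
  have s2 : H ξ - H (reflFst n ξ) = 0 := by
    linear_combination c3 + (H ξ - H (reflFst n ξ)) * hI
  exact (by linear_combination (s1 + s2) / 2 : H ξ = 0)

/-! ### The admissibility constant -/

/-- Since `ψ` is `j`-plane valued, `|F_Q(ψ^*)|²` is the average of the squared modulus of the
complex transform at `ξ` and at its reflection. The weight and Lebesgue measure are invariant under
the reflection, so both halves contribute equally. -/
theorem admConst_eq [NeZero n] {ψ : E n → ℍ[ℝ]} (hψ : MemLp ψ 2 volume)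
    (h0 : (fun z => sndC (ψ z)) =ᵐ[volume] 0) :
    admConst ψ = ∫⁻ ξ : E n, ‖l2Fourier (fun z => fstC (ψ z)) ξ‖ₑ ^ 2 /
      ENNReal.ofReal (|ξ ⟨0, Nat.mul_pos two_pos (NeZero.pos n)⟩| ^ (2 * n)) := by
  have hneg := Measure.measurePreserving_neg (volume : Measure (E n))
  have hinv : MemLp (involution ψ) 2 volume := (hψ.comp_measurePreserving hneg).star
  set G := l2Fourier fun z => fstC (ψ z) with hG
  set Θ : E n → ℝ≥0∞ := fun ξ => ‖G ξ‖ₑ ^ 2 /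
    ENNReal.ofReal (|ξ ⟨0, Nat.mul_pos two_pos (NeZero.pos n)⟩| ^ (2 * n)) with hΘ
  have hΘm : Measurable Θ := by
    refine ((stronglyMeasurable_l2Fourier _).enorm.pow_const 2).div ?_
    fun_prop
  have hR : ∀ {p : E n → Prop}, (∀ᵐ ξ, p ξ) → ∀ᵐ ξ, p (reflFst n ξ) := fun hp =>
    measurePreserving_reflFst.quasiMeasurePreserving.ae hp
  have e1 : (fun z => fstC (involution ψ z)) = fun z => star (fstC (ψ (-z))) := by
    ext1 z; exact fstC_star _
  have e2 : (fun z => sndC (involution ψ z)) =ᵐ[volume] 0 := by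
    filter_upwards [hneg.quasiMeasurePreserving.ae h0] with z hz
    rw [involution, sndC_star, hz]
    simp
  have hf1 : ∀ᵐ ξ, l2Fourier (fun z => fstC (involution ψ z)) ξ = star (G ξ) := by
    rw [e1]; exact l2Fourier_star_neg (h := fun z => fstC (ψ z)) (memLp_fstC hψ)
  have hf2 : ∀ᵐ ξ, l2Fourier (fun z => sndC (involution ψ z)) ξ = 0 := by
    rw [l2Fourier_congr e2]
    have : eLpNorm (l2Fourier (0 : E n → ℂ)) 2 volume = 0 := by
      rw [eLpNorm_l2Fourier MemLp.zero, eLpNorm_zero]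
    exact (eLpNorm_eq_zero_iff (memLp_l2Fourier _).1 two_ne_zero).1 this
  have hmain : admConst ψ = ∫⁻ ξ, (Θ ξ / 2 + Θ (reflFst n ξ) / 2) := by
    refine lintegral_congr_ae ?_
    filter_upwards [qft_ae_eq hinv, hf1, hf2, hR hf1, hR hf2] with ξ h1 h2 h3 h4 h5
    rw [h1, qftL2, twoSidedFun, h2, h3, h4, h5, enorm_sq_twoSided_zero]
    have hc : |reflFst n ξ ⟨0, Nat.mul_pos two_pos (NeZero.pos n)⟩| =
        |ξ ⟨0, Nat.mul_pos two_pos (NeZero.pos n)⟩| := by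
      rw [reflFst_apply, if_pos (NeZero.pos n), abs_neg]
    have hs : ∀ z : ℂ, ‖star z‖ₑ = ‖z‖ₑ := fun z => by
      rw [← ofReal_norm, norm_star, ofReal_norm]
    simp only [hΘ, hc, hs, div_eq_mul_inv]
    ring
  rw [hmain, lintegral_add_left (hΘm.div_const 2)]
  have h2 : ∫⁻ ξ, Θ (reflFst n ξ) / 2 = ∫⁻ ξ, Θ ξ / 2 :=
    measurePreserving_reflFst.lintegral_comp (hΘm.div_const 2)
  rw [h2, ← lintegral_add_left (hΘm.div_const 2)]
  simp only [ENNReal.add_halves, hΘ]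

/-! ### Coordinates `(λ₁, λ')` -/

/-- The point of `ℝ^{2n}` with first coordinate `r` and remaining coordinates `p`. -/
def consPt (r : ℝ) (p : P n) : E n :=
  WithLp.toLp 2 fun k => if k.val = 0 then r else p ⟨k.val - 1, by omega⟩

theorem consPt_apply (r : ℝ) (p : P n) (k : Fin (2 * n)) :
    consPt r p k = if k.val = 0 then r else p ⟨k.val - 1, by omega⟩ := rfl

theorem measurePreserving_consPt [NeZero n] :
    MeasurePreserving (fun q : ℝ × P n => consPt q.1 q.2) volume volume := by
  -- The dimension `2n` is generalized to `N` so that it can be replaced by a literal successor `m +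
  -- 1`.
  have key : ∀ (N m : ℕ) (hN : N = m + 1), MeasurePreserving
      (fun q : ℝ × EuclideanSpace ℝ (Fin m) => (WithLp.toLp 2 fun k : Fin N =>
        if hk : k.val = 0 then q.1 else q.2 ⟨k.val - 1, by omega⟩ : EuclideanSpace ℝ (Fin N)))
      volume volume := by
    intro N m hN
    subst hN
    have h1 : MeasurePreserving (Prod.map id WithLp.ofLp :
        ℝ × EuclideanSpace ℝ (Fin m) → ℝ × (Fin m → ℝ)) volume volume :=
      (MeasurePreserving.id volume).prod (PiLp.volume_preserving_ofLp (Fin m))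
    have h2 := (volume_preserving_piFinSuccAbove (fun _ : Fin (m + 1) => ℝ) 0).symm
    have h3 := (PiLp.volume_preserving_toLp (Fin (m + 1))).comp (h2.comp h1)
    convert! h3 using 1
    ext q k
    refine Fin.cases ?_ (fun i => ?_) k
    · simp
    · simp
  have hn := NeZero.pos n
  have := key (2 * n) (2 * n - 1) (by omega)
  convert! this using 1

theorem exists_consPt [NeZero n] (ξ : E n) :
    ∃ p : P n, ξ = consPt (ξ ⟨0, Nat.mul_pos two_pos (NeZero.pos n)⟩) p := by
  refine ⟨WithLp.toLp 2 fun k => ξ ⟨k.val + 1, by omega⟩, ?_⟩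
  ext k
  rw [consPt_apply]
  split_ifs with hk
  · exact congrArg ξ (Fin.ext hk)
  · exact congrArg ξ (Fin.ext (by simp; omega))

theorem lintegral_consPt [NeZero n] {Θ : E n → ℝ≥0∞} (hΘ : Measurable Θ) :
    ∫⁻ ξ, Θ ξ = ∫⁻ r, ∫⁻ p : P n, Θ (consPt r p) := by
  rw [← measurePreserving_consPt.lintegral_comp hΘ, Measure.volume_eq_prod,
    lintegral_prod (fun q : ℝ × P n => Θ (consPt q.1 q.2))
      (hΘ.comp measurePreserving_consPt.measurable).aemeasurable]

theorem lintegral_comp_add_smul {V : Type*} [NormedAddCommGroup V] [NormedSpace ℝ V]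
    [MeasurableSpace V] [BorelSpace V] [FiniteDimensional ℝ V] (μ : Measure V)
    [μ.IsAddHaarMeasure] {Θ : V → ℝ≥0∞} (hΘ : Measurable Θ) (v : V) {r : ℝ} (hr : r ≠ 0) :
    ∫⁻ s, Θ (v + r • s) ∂μ =
      ENNReal.ofReal ((|r| ^ Module.finrank ℝ V)⁻¹) * ∫⁻ s, Θ s ∂μ := by
  have h1 : ∫⁻ s, Θ (v + r • s) ∂μ = ∫⁻ x, Θ (v + x) ∂(μ.map (r • ·)) :=
    (lintegral_map (hΘ.comp (by fun_prop)) (by fun_prop)).symm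
  rw [h1, Measure.map_addHaar_smul μ hr, lintegral_smul_measure, lintegral_add_left_eq_self,
    abs_inv, abs_pow, smul_eq_mul]

/-! ### The linear maps `S_s A_a` -/

/-- The invertible linear map given by an invertible matrix. -/
def matEquiv {N : ℕ} (M : Matrix (Fin N) (Fin N) ℝ) (hM : IsUnit M.det) :
    EuclideanSpace ℝ (Fin N) ≃L[ℝ] EuclideanSpace ℝ (Fin N) :=
  ContinuousLinearEquiv.equivOfInverse (Matrix.toEuclideanCLM (𝕜 := ℝ) M)
    (Matrix.toEuclideanCLM (𝕜 := ℝ) M⁻¹)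
    (fun x => by
      rw [← mul_apply_eq_comp, ← map_mul, Matrix.nonsing_inv_mul M hM, map_one]; rfl)
    (fun x => by
      rw [← mul_apply_eq_comp, ← map_mul, Matrix.mul_nonsing_inv M hM, map_one]; rfl)

theorem matEquiv_apply {N : ℕ} {M : Matrix (Fin N) (Fin N) ℝ} (hM : IsUnit M.det)
    (x : EuclideanSpace ℝ (Fin N)) : matEquiv M hM x = WithLp.toLp 2 (M *ᵥ WithLp.ofLp x) := rfl

theorem matEquiv_symm_apply {N : ℕ} {M : Matrix (Fin N) (Fin N) ℝ} (hM : IsUnit M.det)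
    (x : EuclideanSpace ℝ (Fin N)) :
    (matEquiv M hM).symm x = WithLp.toLp 2 (M⁻¹ *ᵥ WithLp.ofLp x) := rfl

theorem det_matEquiv {N : ℕ} {M : Matrix (Fin N) (Fin N) ℝ} (hM : IsUnit M.det) :
    LinearMap.det
      (matEquiv M hM : EuclideanSpace ℝ (Fin N) →ₗ[ℝ] EuclideanSpace ℝ (Fin N)) = M.det := by
  rw [← LinearMap.det_toLin' M,
    ← LinearMap.det_conj (Matrix.toLin' M) (WithLp.linearEquiv 2 ℝ (Fin N → ℝ)).symm]
  rfl

theorem inner_matEquiv {N : ℕ} {M : Matrix (Fin N) (Fin N) ℝ} (hM : IsUnit M.det)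
    (hM' : IsUnit Mᵀ.det) (y ξ : EuclideanSpace ℝ (Fin N)) :
    inner ℝ (matEquiv M hM y) ξ = inner ℝ y (matEquiv Mᵀ hM' ξ) := by
  rw [EuclideanSpace.inner_eq_star_dotProduct, EuclideanSpace.inner_eq_star_dotProduct]
  simp only [matEquiv_apply, star_trivial]
  rw [Matrix.dotProduct_mulVec, Matrix.mulVec_transpose]

/-- The dilation factor of the coordinates other than the first one. -/
def dilFactor (n : ℕ) (a : ℝ) : ℝ := Real.sign a * |a| ^ (1 / (2 * n : ℝ))

theorem dilFactor_ne_zero {a : ℝ} (ha : a ≠ 0) : dilFactor n a ≠ 0 :=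
  mul_ne_zero (by rwa [Ne, Real.sign_eq_zero_iff])
    (Real.rpow_pos_of_pos (abs_pos.2 ha) _).ne'

theorem abs_dilFactor {a : ℝ} (ha : a ≠ 0) : |dilFactor n a| = |a| ^ (1 / (2 * n : ℝ)) := by
  have h : |Real.sign a| = 1 := by
    rcases Real.sign_apply_eq_of_ne_zero a ha with h | h <;> rw [h] <;> simp
  rw [dilFactor, abs_mul, h, one_mul, abs_of_pos (Real.rpow_pos_of_pos (abs_pos.2 ha) _)]

theorem det_shearMat (s : P n) : (shearMat s).det = 1 := by
  rw [Matrix.det_of_isUpperTriangular]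
  · simp [shearMat]
  · intro k l hkl
    have h : l < k := hkl
    have h1 : k ≠ l := h.ne'
    have h2 : k.val ≠ 0 := by have := Fin.lt_def.1 h; omega
    simp [shearMat, h1, h2]

theorem det_dilMat [NeZero n] (a : ℝ) : (dilMat n a).det = a * dilFactor n a ^ (2 * n - 1) := by
  have key : ∀ (N m : ℕ) (hN : N = m + 1) (d : ℝ),
      ∏ k : Fin N, (if k.val = 0 then a else d) = a * d ^ m := by
    intro N m hN d
    subst hN
    rw [Fin.prod_univ_succ]
    simp
  rw [dilMat, Matrix.det_diagonal]
  exact key _ _ (by have := NeZero.pos n; omega) _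

theorem isUnit_det_shear_mul_dil [NeZero n] {a : ℝ} (ha : a ≠ 0) (s : P n) :
    IsUnit (shearMat s * dilMat n a).det := by
  rw [Matrix.det_mul, det_shearMat, one_mul, det_dilMat, isUnit_iff_ne_zero]
  exact mul_ne_zero ha (pow_ne_zero _ (dilFactor_ne_zero ha))

theorem isUnit_det_transpose [NeZero n] {a : ℝ} (ha : a ≠ 0) (s : P n) :
    IsUnit (shearMat s * dilMat n a)ᵀ.det := by
  rw [Matrix.det_transpose]; exact isUnit_det_shear_mul_dil ha s

/-- The action of `(S_s A_a)ᵀ` on frequencies. -/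
def freqMap (n : ℕ) [NeZero n] (a : ℝ) (s : P n) (ξ : E n) : E n :=
  consPt (a * ξ ⟨0, Nat.mul_pos two_pos (NeZero.pos n)⟩)
    (WithLp.toLp 2 fun k => dilFactor n a * (ξ ⟨k.val + 1, by omega⟩ +
      ξ ⟨0, Nat.mul_pos two_pos (NeZero.pos n)⟩ * s k))

theorem matEquiv_transpose_apply [NeZero n] {a : ℝ} (ha : a ≠ 0) (s : P n) (ξ : E n) :
    matEquiv (shearMat s * dilMat n a)ᵀ (isUnit_det_transpose ha s) ξ = freqMap n a s ξ := by
  have hn := NeZero.pos n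
  set z : Fin (2 * n) := ⟨0, Nat.mul_pos two_pos (NeZero.pos n)⟩ with hz
  rw [matEquiv_apply]
  ext k
  rw [freqMap, consPt_apply, Matrix.transpose_mul, ← Matrix.mulVec_mulVec, dilMat,
    Matrix.diagonal_transpose]
  simp only [Matrix.mulVec_diagonal]
  have hsum : ((shearMat s)ᵀ *ᵥ WithLp.ofLp ξ) k =
      if hk : k.val = 0 then ξ z else ξ k + ξ z * s ⟨k.val - 1, by omega⟩ := by
    rw [Matrix.mulVec, dotProduct]
    simp only [Matrix.transpose_apply, shearMat, Matrix.of_apply]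
    split_ifs with hk
    · rw [Finset.sum_eq_single z]
      · rw [if_pos (Fin.ext hk.symm), one_mul]
      · intro l _ hl
        rw [if_neg (fun h => hl (by rw [h]; exact Fin.ext hk)),
          if_neg (fun h => hl (Fin.ext h)), zero_mul]
      · simp
    · have hkz : k ≠ z := fun h => hk (by rw [h])
      -- Column `k` of the shear matrix has two entries that may be nonzero: the diagonal one and
      -- the one in the first row.
      rw [Finset.sum_eq_add k z hkz]
      · rw [if_pos rfl, if_neg hkz.symm, if_pos rfl]; ring
      · rintro l _ ⟨h1, h2⟩
        rw [if_neg h1, if_neg (fun h => h2 (Fin.ext h)), zero_mul]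
      · simp
      · simp
  rw [hsum]
  by_cases hk : k.val = 0
  · simp only [hk, if_true, dif_pos]
    rfl
  · simp only [hk, if_false, dif_neg, not_false_iff]
    have h2 : (⟨k.val - 1 + 1, by omega⟩ : Fin (2 * n)) = k := Fin.ext (by simp; omega)
    rw [h2]
    rfl

theorem freqMap_consPt [NeZero n] (a r : ℝ) (s p : P n) :
    freqMap n a s (consPt r p) =
      consPt (a * r) (dilFactor n a • p + (dilFactor n a * r) • s) := by
  rw [freqMap, consPt_apply, if_pos rfl]
  congr 1
  ext k
  simp [consPt_apply]
  ring

theorem measurable_dilFactor : Measurable (dilFactor n) := by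
  have h : Measurable Real.sign := by
    unfold Real.sign
    exact Measurable.ite measurableSet_Iio measurable_const
      (Measurable.ite measurableSet_Ioi measurable_const measurable_const)
  unfold dilFactor
  fun_prop

theorem measurable_freqMap [NeZero n] :
    Measurable fun q : (ℝ × P n) × E n => freqMap n q.1.1 q.1.2 q.2 := by
  refine measurePreserving_consPt.measurable.comp (Measurable.prodMk (by fun_prop) ?_)
  refine (WithLp.measurable_toLp 2 _).comp (measurable_pi_lambda _ fun k => ?_)
  have := measurable_dilFactor (n := n)
  fun_prop

/-- The map `x ↦ A_a⁻¹ S_s⁻¹ (x - t)`. -/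
def shearInv (n : ℕ) (q : ℝ × P n × E n) (x : E n) : E n :=
  WithLp.toLp 2 ((dilMat n q.1)⁻¹ *ᵥ ((shearMat q.2.1)⁻¹ *ᵥ (WithLp.ofLp (x - q.2.2))))

theorem shearInv_eq [NeZero n] {a : ℝ} (ha : a ≠ 0) (s : P n) (t x : E n) :
    shearInv n (a, s, t) x =
      (matEquiv (shearMat s * dilMat n a) (isUnit_det_shear_mul_dil ha s)).symm (x - t) := by
  rw [matEquiv_symm_apply, Matrix.mul_inv_rev, ← Matrix.mulVec_mulVec]
  rfl

theorem measurable_shearInv :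
    Measurable fun p : (ℝ × P n × E n) × E n => shearInv n p.1 p.2 := by
  have hd := measurable_dilFactor (n := n)
  have hS : Continuous fun s : P n => (shearMat s)⁻¹ := by
    have h1 : (fun s : P n => (shearMat s)⁻¹) = fun s => (shearMat s).adjugate := by
      -- The shear has determinant `1`, so its inverse is its adjugate, which is polynomial in `s`.
      ext1 s
      rw [Matrix.inv_def, det_shearMat, Ring.inverse_one, one_smul]
    rw [h1]
    refine Continuous.matrix_adjugate (continuous_matrix fun k l => ?_)
    simp only [shearMat, Matrix.of_apply]
    split_ifs <;> fun_prop
  have hSx : Continuous fun p : (ℝ × P n × E n) × E n =>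
      (shearMat p.1.2.1)⁻¹ *ᵥ (WithLp.ofLp (p.2 - p.1.2.2)) :=
    (hS.comp (by fun_prop : Continuous fun p : (ℝ × P n × E n) × E n => p.1.2.1)).matrix_mulVec
      (by fun_prop)
  have hD : ∀ a : ℝ, (dilMat n a)⁻¹ = Matrix.diagonal fun k =>
      (if k.val = 0 then a else dilFactor n a)⁻¹ := by
    intro a
    -- The formula also holds at `a = 0`: there the matrix is zero, and the default inverses of the
    -- zero matrix and of the number `0` are both zero.
    rcases eq_or_ne a 0 with rfl | ha
    · have h0 : dilMat n 0 = 0 := by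
        ext k l
        simp [dilMat, Matrix.diagonal_apply]
      rw [h0, Matrix.inv_zero]
      ext k l
      simp [dilFactor, Matrix.diagonal_apply]
    · apply Matrix.inv_eq_right_inv
      rw [dilMat, Matrix.diagonal_mul_diagonal, ← Matrix.diagonal_one]
      congr 1
      ext k
      split_ifs
      · exact mul_inv_cancel₀ ha
      · exact mul_inv_cancel₀ (dilFactor_ne_zero ha)
  refine (WithLp.measurable_toLp 2 _).comp (measurable_pi_lambda _ fun k => ?_)
  simp only [hD, Matrix.mulVec_diagonal]
  refine Measurable.mul ?_ ((measurable_pi_apply k).comp hSx.measurable)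
  split_ifs <;> fun_prop

/-! ### The complex shearlet transform -/

/-- The Jacobian factor in the Plancherel formula for the shearlet transform. -/
def shearWeight (n : ℕ) (a : ℝ) : ℝ :=
  (|a| ^ (1 / (4 * n : ℝ) - 1)) ^ 2 * (a * dilFactor n a ^ (2 * n - 1)) ^ 2 *
    (1 / |a| ^ (2 * n + 1))

theorem shearWeight_pos {a : ℝ} (ha : a ≠ 0) : 0 < shearWeight n a := by
  have h1 := abs_pos.2 ha
  have h2 := Real.rpow_pos_of_pos h1 (1 / (4 * n : ℝ) - 1)
  have h3 : a * dilFactor n a ^ (2 * n - 1) ≠ 0 :=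
    mul_ne_zero ha (pow_ne_zero _ (dilFactor_ne_zero ha))
  unfold shearWeight
  positivity

theorem measurable_shearWeight : Measurable (shearWeight n) := by
  have := measurable_dilFactor (n := n)
  unfold shearWeight
  fun_prop

/-- Put `δ = |dilFactor n a|`, so that `|a| = δ^{2n}`. The squared normalization is `δ/|a|²` and the
squared determinant is `|a|² δ^{2(2n-1)}`; after division by `|δr|^{2n-1}` the remaining power
`δ^{2n}` is `|a|`, which lowers the Haar exponent `2n+1` to `2n`. -/
theorem shearWeight_mul [NeZero n] {a r : ℝ} (ha : a ≠ 0) (hr : r ≠ 0) :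
    shearWeight n a * (|dilFactor n a * r| ^ (2 * n - 1))⁻¹ = |r| * (|a * r| ^ (2 * n))⁻¹ := by
  have hn : (n : ℝ) ≠ 0 := NeZero.ne _
  obtain ⟨m, hm⟩ : ∃ m, 2 * n = m + 1 := ⟨2 * n - 1, by have := NeZero.pos n; omega⟩
  have hA := abs_pos.2 ha
  have hr' := abs_pos.2 hr
  have hδ := abs_dilFactor (n := n) ha
  have hδ0 : 0 < |dilFactor n a| := abs_pos.2 (dilFactor_ne_zero ha)
  have h1 : |dilFactor n a| ^ (2 * n) = |a| := by
    rw [hδ, ← Real.rpow_natCast, ← Real.rpow_mul hA.le]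
    push_cast
    rw [one_div_mul_cancel (by positivity), Real.rpow_one]
  have h2 : (|a| ^ (1 / (4 * n : ℝ) - 1)) ^ 2 = |dilFactor n a| / |a| ^ 2 := by
    rw [hδ, ← Real.rpow_natCast, ← Real.rpow_mul hA.le, ← Real.rpow_natCast |a| 2,
      ← Real.rpow_sub hA]
    congr 1
    push_cast
    field_simp
    ring
  have h3 : (a * dilFactor n a ^ (2 * n - 1)) ^ 2 =
      |a| ^ 2 * (|dilFactor n a| ^ (2 * n - 1)) ^ 2 := by
    rw [mul_pow, ← sq_abs a, ← sq_abs (dilFactor n a ^ _), abs_pow]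
  rw [shearWeight, h2, h3, abs_mul, abs_mul]
  rw [hm] at h1 ⊢
  rw [Nat.add_sub_cancel]
  set δ := |dilFactor n a|
  rw [← h1]
  field_simp
  ring

/-- For fixed `ξ` with `ξ₁ ≠ 0` the map `(a,s) ↦ (S_s A_a)ᵀ ξ` parametrizes almost all frequencies.
Its Jacobian turns the weight into `|η₁|^{-2n}`, independently of `ξ`. -/
theorem lintegral_freqMap [NeZero n] {Θ : E n → ℝ≥0∞} (hΘ : Measurable Θ) {ξ : E n}
    (hξ : ξ ⟨0, Nat.mul_pos two_pos (NeZero.pos n)⟩ ≠ 0) :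
    ∫⁻ q : ℝ × P n, ENNReal.ofReal (shearWeight n q.1) * Θ (freqMap n q.1 q.2 ξ) =
      ∫⁻ η : E n, Θ η /
        ENNReal.ofReal (|η ⟨0, Nat.mul_pos two_pos (NeZero.pos n)⟩| ^ (2 * n)) := by
  obtain ⟨p, hp⟩ := exists_consPt ξ
  set r := ξ ⟨0, Nat.mul_pos two_pos (NeZero.pos n)⟩
  rw [hp]
  have hae : ∀ᵐ b : ℝ, b ≠ 0 := by simp [ae_iff]
  have hcm : Measurable fun q : ℝ × P n => consPt q.1 q.2 := measurePreserving_consPt.measurable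
  set g : ℝ → ℝ≥0∞ := fun b =>
    ENNReal.ofReal ((|b| ^ (2 * n))⁻¹) * ∫⁻ p : P n, Θ (consPt b p) with hg
  have hgm : Measurable g := by
    refine Measurable.mul (by fun_prop) ?_
    exact Measurable.lintegral_prod_right' (f := fun q : ℝ × P n => Θ (consPt q.1 q.2))
      (hΘ.comp hcm)
  have hrhs : ∫⁻ η : E n, Θ η /
      ENNReal.ofReal (|η ⟨0, Nat.mul_pos two_pos (NeZero.pos n)⟩| ^ (2 * n)) = ∫⁻ b, g b := by
    rw [lintegral_consPt (Θ := fun η : E n => Θ η /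
      ENNReal.ofReal (|η ⟨0, Nat.mul_pos two_pos (NeZero.pos n)⟩| ^ (2 * n)))
      (hΘ.div (by fun_prop))]
    refine lintegral_congr_ae ?_
    filter_upwards [hae] with b hb
    have hb' : 0 < |b| ^ (2 * n) := pow_pos (abs_pos.2 hb) _
    simp only [consPt_apply, if_true, hg, div_eq_mul_inv]
    rw [lintegral_mul_const' _ _ (ENNReal.inv_ne_top.2 (ENNReal.ofReal_pos.2 hb').ne'),
      ENNReal.ofReal_inv_of_pos hb', mul_comm]
  -- For fixed `a`, the substitution in `s` has factor `|δr|^{-(2n-1)}` and its shift is harmless by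
  -- translation invariance. The outer variable is written `0 + r • a` so that the same substitution
  -- lemma then absorbs the factor `|r|`.
  have hlhs : ∫⁻ q : ℝ × P n,
      ENNReal.ofReal (shearWeight n q.1) * Θ (freqMap n q.1 q.2 (consPt r p)) =
      ∫⁻ a, ENNReal.ofReal |r| * g (0 + r • a) := by
    rw [Measure.volume_eq_prod, lintegral_prod]
    · refine lintegral_congr_ae ?_
      filter_upwards [hae] with a ha
      have hd := mul_ne_zero (dilFactor_ne_zero (n := n) ha) hξ
      simp only [freqMap_consPt]
      rw [lintegral_const_mul' _ _ ENNReal.ofReal_ne_top,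
        lintegral_comp_add_smul volume (Θ := fun p => Θ (consPt (a * r) p))
          (hΘ.comp (hcm.comp measurable_prodMk_left)) _ hd, finrank_euclideanSpace_fin,
        ← mul_assoc, ← ENNReal.ofReal_mul (shearWeight_pos ha).le, shearWeight_mul ha hξ,
        ENNReal.ofReal_mul (abs_nonneg _), mul_assoc, zero_add, smul_eq_mul, mul_comm r a]
    · refine (Measurable.mul ?_ (hΘ.comp ?_)).aemeasurable
      · exact (measurable_shearWeight.comp measurable_fst).ennreal_ofReal
      · exact measurable_freqMap.comp (measurable_id.prodMk measurable_const)
  rw [hlhs, hrhs, lintegral_const_mul' _ _ ENNReal.ofReal_ne_top,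
    lintegral_comp_add_smul volume hgm 0 hξ, Module.finrank_self, pow_one, ← mul_assoc,
    ← ENNReal.ofReal_mul (abs_nonneg _), mul_inv_cancel₀ (abs_ne_zero.2 hξ), ENNReal.ofReal_one,
    one_mul]

/-- The complex shearlet transform, without the normalizing power of the dilation. -/
def shearCorr (g f : E n → ℂ) (q : ℝ × P n × E n) : ℂ :=
  ∫ x, f x * star (g (shearInv n q x))

theorem lintegral_shearCorr [NeZero n] {f g : E n → ℂ} (hf : MemLp f 2 volume)
    (hg : MemLp g 2 volume) {a : ℝ} (ha : a ≠ 0) (s : P n)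
    (hfin : ∫⁻ ξ, ‖l2Fourier f ξ‖ₑ ^ 2 * ‖l2Fourier g (freqMap n a s ξ)‖ₑ ^ 2 < ∞) :
    ∫⁻ t, ENNReal.ofReal (1 / |a| ^ (2 * n + 1)) *
        ‖(|a| ^ (1 / (4 * n : ℝ) - 1)) • shearCorr g f (a, s, t)‖ₑ ^ 2 =
      ENNReal.ofReal (shearWeight n a) *
        ∫⁻ ξ, ‖l2Fourier f ξ‖ₑ ^ 2 * ‖l2Fourier g (freqMap n a s ξ)‖ₑ ^ 2 := by
  simp only [← matEquiv_transpose_apply ha] at hfin ⊢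
  have h := lintegral_enorm_sq_correlation
    (matEquiv (shearMat s * dilMat n a) (isUnit_det_shear_mul_dil ha s))
    (matEquiv (shearMat s * dilMat n a)ᵀ (isUnit_det_transpose ha s))
    (inner_matEquiv _ _) hf hg hfin
  rw [det_matEquiv, Matrix.det_mul, det_shearMat, one_mul, det_dilMat] at h
  simp only [← shearInv_eq ha] at h
  have hpos := Real.rpow_pos_of_pos (abs_pos.2 ha) (1 / (4 * n : ℝ) - 1)
  simp only [enorm_smul, mul_pow, shearCorr]
  rw [lintegral_const_mul' _ _ ENNReal.ofReal_ne_top, lintegral_const_mul' _ _ (by simp), h,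
    shearWeight, ENNReal.ofReal_mul (by positivity), ENNReal.ofReal_mul (by positivity),
    Real.enorm_of_nonneg hpos.le, ENNReal.ofReal_pow hpos.le]
  ring

theorem lintegral_enorm_sq_l2Fourier {f : E n → ℂ} (hf : MemLp f 2 volume) :
    ∫⁻ ξ, ‖l2Fourier f ξ‖ₑ ^ 2 = ∫⁻ x, ‖f x‖ₑ ^ 2 := by
  rw [← eLpNorm_two_sq, ← eLpNorm_two_sq, eLpNorm_l2Fourier hf]

/-- Plancherel's theorem for the complex shearlet transform. -/
theorem lintegral_shearCorr_prod [NeZero n] {f g : E n → ℂ} (hf : MemLp f 2 volume)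
    (hg : MemLp g 2 volume)
    (hC : ∫⁻ ξ : E n, ‖l2Fourier g ξ‖ₑ ^ 2 /
      ENNReal.ofReal (|ξ ⟨0, Nat.mul_pos two_pos (NeZero.pos n)⟩| ^ (2 * n)) < ∞) :
    ∫⁻ q : ℝ × P n, ∫⁻ t, ENNReal.ofReal (1 / |q.1| ^ (2 * n + 1)) *
        ‖(|q.1| ^ (1 / (4 * n : ℝ) - 1)) • shearCorr g f (q.1, q.2, t)‖ₑ ^ 2 =
      (∫⁻ ξ : E n, ‖l2Fourier g ξ‖ₑ ^ 2 /
        ENNReal.ofReal (|ξ ⟨0, Nat.mul_pos two_pos (NeZero.pos n)⟩| ^ (2 * n))) *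
        ∫⁻ x, ‖f x‖ₑ ^ 2 := by
  set C := ∫⁻ ξ : E n, ‖l2Fourier g ξ‖ₑ ^ 2 /
    ENNReal.ofReal (|ξ ⟨0, Nat.mul_pos two_pos (NeZero.pos n)⟩| ^ (2 * n))
  set Θ : E n → ℝ≥0∞ := fun ξ => ‖l2Fourier g ξ‖ₑ ^ 2 with hΘ
  have hΘm : Measurable Θ := (stronglyMeasurable_l2Fourier g).enorm.pow_const 2
  have hfm : Measurable fun ξ => ‖l2Fourier f ξ‖ₑ ^ 2 :=
    (stronglyMeasurable_l2Fourier f).enorm.pow_const 2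
  set X : ℝ × P n → ℝ≥0∞ := fun q =>
    ∫⁻ ξ, ‖l2Fourier f ξ‖ₑ ^ 2 * Θ (freqMap n q.1 q.2 ξ) with hX
  have hXm : Measurable X := by
    exact Measurable.lintegral_prod_right' (f := fun p : (ℝ × P n) × E n =>
      ‖l2Fourier f p.2‖ₑ ^ 2 * Θ (freqMap n p.1.1 p.1.2 p.2))
      ((hfm.comp measurable_snd).mul (hΘm.comp measurable_freqMap))
  have hwm : Measurable fun q : ℝ × P n => ENNReal.ofReal (shearWeight n q.1) :=
    (measurable_shearWeight.comp measurable_fst).ennreal_ofReal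
  have hY : ∫⁻ q : ℝ × P n, ENNReal.ofReal (shearWeight n q.1) * X q =
      C * ∫⁻ x, ‖f x‖ₑ ^ 2 := by
    calc ∫⁻ q : ℝ × P n, ENNReal.ofReal (shearWeight n q.1) * X q
        = ∫⁻ q : ℝ × P n, ∫⁻ ξ, ‖l2Fourier f ξ‖ₑ ^ 2 *
            (ENNReal.ofReal (shearWeight n q.1) * Θ (freqMap n q.1 q.2 ξ)) := by
          refine lintegral_congr fun q => ?_
          rw [hX, ← lintegral_const_mul' _ _ ENNReal.ofReal_ne_top]
          refine lintegral_congr fun ξ => ?_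
          ring
      _ = ∫⁻ ξ, ∫⁻ q : ℝ × P n, ‖l2Fourier f ξ‖ₑ ^ 2 *
            (ENNReal.ofReal (shearWeight n q.1) * Θ (freqMap n q.1 q.2 ξ)) := by
          refine lintegral_lintegral_swap (Measurable.aemeasurable ?_)
          exact (hfm.comp measurable_snd).mul
            ((hwm.comp measurable_fst).mul (hΘm.comp measurable_freqMap))
      _ = ∫⁻ ξ, ‖l2Fourier f ξ‖ₑ ^ 2 * C := by
          refine lintegral_congr_ae ?_
          filter_upwards [ae_apply_ne_zero
            (⟨0, Nat.mul_pos two_pos (NeZero.pos n)⟩ : Fin (2 * n))] with ξ hξ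
          rw [lintegral_const_mul' _ _ (by simp), lintegral_freqMap hΘm hξ]
      _ = C * ∫⁻ x, ‖f x‖ₑ ^ 2 := by
          rw [lintegral_mul_const _ hfm, lintegral_enorm_sq_l2Fourier hf, mul_comm]
  have hfin : ∫⁻ x, ‖f x‖ₑ ^ 2 < ∞ := by
    rw [← eLpNorm_two_sq]
    exact ENNReal.pow_lt_top hf.2
  -- The total integral is finite, so the frequency integral is finite for almost every `(a,s)`.
  -- This supplies the `L²` condition needed for Plancherel in `t`.
  have hlt : ∀ᵐ q : ℝ × P n, ENNReal.ofReal (shearWeight n q.1) * X q < ∞ := by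
    refine ae_lt_top (hwm.mul hXm) ?_
    rw [hY]
    exact (ENNReal.mul_lt_top hC hfin).ne
  have hae : ∀ᵐ q : ℝ × P n, q.1 ≠ 0 :=
    Measure.quasiMeasurePreserving_fst.ae (by simp [ae_iff] : ∀ᵐ b : ℝ, b ≠ 0)
  rw [← hY]
  refine lintegral_congr_ae ?_
  filter_upwards [hlt, hae] with q h1 h2
  refine lintegral_shearCorr hf hg h2 q.2 (lt_of_not_ge fun h3 => ?_)
  have h4 : X q = ∞ := top_le_iff.1 h3
  rw [h4, ENNReal.mul_top (by simpa using shearWeight_pos h2)] at h1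
  exact lt_irrefl _ h1

/-! ### The quaternion shearlet transform -/

theorem shearlet_eq (ψ : E n → ℍ[ℝ]) (q : ℝ × P n × E n) (x : E n) :
    shearlet ψ q.1 q.2.1 q.2.2 x = (|q.1| ^ (1 / (4 * n : ℝ) - 1)) • ψ (shearInv n q x) := rfl

theorem map_shearInv_volume [NeZero n] {q : ℝ × P n × E n} (hq : q.1 ≠ 0) :
    Measurable (shearInv n q) ∧ ∃ c : ℝ≥0∞, c ≠ ∞ ∧
      (volume : Measure (E n)).map (shearInv n q) = c • volume := by
  obtain ⟨a, s, t⟩ := q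
  have h1 := map_affine_volume
    (matEquiv (shearMat s * dilMat n a) (isUnit_det_shear_mul_dil hq s)) t
  have h2 := measurable_affine
    (matEquiv (shearMat s * dilMat n a) (isUnit_det_shear_mul_dil hq s)) t
  simp only [← shearInv_eq hq] at h1 h2
  exact ⟨h2, _, ENNReal.ofReal_ne_top, h1⟩

theorem memLp_shearlet [NeZero n] {ψ : E n → ℍ[ℝ]} (hψ : MemLp ψ 2 volume)
    {q : ℝ × P n × E n} (hq : q.1 ≠ 0) :
    MemLp (fun x => shearlet ψ q.1 q.2.1 q.2.2 x) 2 volume := by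
  obtain ⟨hm, c, hc, hmap⟩ := map_shearInv_volume hq
  exact (memLp_comp_of_map_eq_smul hm hmap hc hψ).const_smul
    (|q.1| ^ (1 / (4 * n : ℝ) - 1))

theorem integrable_mul_star_shearlet [NeZero n] {ψ f : E n → ℍ[ℝ]} (hψ : MemLp ψ 2 volume)
    (hf : MemLp f 2 volume) {q : ℝ × P n × E n} (hq : q.1 ≠ 0) :
    Integrable fun x => f x * star (shearlet ψ q.1 q.2.1 q.2.2 x) :=
  hf.integrable_mul (memLp_shearlet hψ hq).star

theorem SH_add [NeZero n] {ψ f g : E n → ℍ[ℝ]} (hψ : MemLp ψ 2 volume)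
    (hf : MemLp f 2 volume) (hg : MemLp g 2 volume) {q : ℝ × P n × E n} (hq : q.1 ≠ 0) :
    SH ψ (f + g) q = SH ψ f q + SH ψ g q := by
  rw [SH, SH, SH, ← integral_add (integrable_mul_star_shearlet hψ hf hq)
    (integrable_mul_star_shearlet hψ hg hq)]
  simp only [Pi.add_apply, add_mul]

/-- When `q` lies in the `j`-plane, `(z + i w) q̄ = z q̄ + i (w q̄)`. -/
theorem fstC_mul_star {p q : ℍ[ℝ]} (hq : sndC q = 0) :
    fstC (p * star q) = fstC p * star (fstC q) := by
  have h1 : q.imI = 0 := congrArg Complex.re hq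
  have h2 : q.imK = 0 := congrArg Complex.im hq
  apply Complex.ext
  · simp [Quaternion.re_mul, h1, h2]
  · simp [Quaternion.imJ_mul, h1, h2]

theorem sndC_mul_star {p q : ℍ[ℝ]} (hq : sndC q = 0) :
    sndC (p * star q) = sndC p * star (fstC q) := by
  have h1 : q.imI = 0 := congrArg Complex.re hq
  have h2 : q.imK = 0 := congrArg Complex.im hq
  apply Complex.ext
  · simp [Quaternion.imI_mul, h1, h2]
  · simp [Quaternion.imK_mul, h1, h2]

theorem SH_eq_mkQ [NeZero n] {ψ f : E n → ℍ[ℝ]} (hψ : MemLp ψ 2 volume)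
    (hf : MemLp f 2 volume) (h0 : (fun z => sndC (ψ z)) =ᵐ[volume] 0) {g f₁ f₂ : E n → ℂ}
    (hg : (fun z => fstC (ψ z)) =ᵐ[volume] g) (hf₁ : (fun z => fstC (f z)) =ᵐ[volume] f₁)
    (hf₂ : (fun z => sndC (f z)) =ᵐ[volume] f₂) {q : ℝ × P n × E n} (hq : q.1 ≠ 0) :
    SH ψ f q = mkQ ((|q.1| ^ (1 / (4 * n : ℝ) - 1)) • shearCorr g f₁ q)
      ((|q.1| ^ (1 / (4 * n : ℝ) - 1)) • shearCorr g f₂ q) := by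
  obtain ⟨hm, c, hc, hmap⟩ := map_shearInv_volume hq
  have hI := integrable_mul_star_shearlet hψ hf hq
  have h0' := ae_comp_of_map_eq_smul hm hmap h0
  have hg' := ae_comp_of_map_eq_smul hm hmap hg
  apply ext_fstC_sndC
  · rw [fstC_mkQ, SH, ← fstC.integral_comp_comm hI, shearCorr, ← integral_smul]
    refine integral_congr_ae ?_
    filter_upwards [h0', hg', hf₁] with x h1 h2 h3
    have h4 : sndC (ψ (shearInv n q x)) = 0 := h1
    rw [shearlet_eq, fstC_mul_star (by rw [map_smul, h4, smul_zero]), h3, map_smul, h2,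
      star_smul, mul_smul_comm, star_trivial]
  · rw [sndC_mkQ, SH, ← sndC.integral_comp_comm hI, shearCorr, ← integral_smul]
    refine integral_congr_ae ?_
    filter_upwards [h0', hg', hf₂] with x h1 h2 h3
    have h4 : sndC (ψ (shearInv n q x)) = 0 := h1
    rw [shearlet_eq, sndC_mul_star (by rw [map_smul, h4, smul_zero]), h3, map_smul, h2,
      star_smul, mul_smul_comm, star_trivial]

theorem stronglyMeasurable_shearCorr {g f : E n → ℂ} (hg : StronglyMeasurable g)
    (hf : StronglyMeasurable f) :
    StronglyMeasurable fun q : ℝ × P n × E n =>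
      (|q.1| ^ (1 / (4 * n : ℝ) - 1)) • shearCorr g f q := by
  have hpow : Measurable fun q : ℝ × P n × E n => |q.1| ^ (1 / (4 * n : ℝ) - 1) := by fun_prop
  refine hpow.stronglyMeasurable.smul ?_
  refine StronglyMeasurable.integral_prod_right
    (f := fun (q : ℝ × P n × E n) (x : E n) => f x * star (g (shearInv n q x))) ?_
  exact (hf.comp_measurable measurable_snd).mul (hg.comp_measurable measurable_shearInv).star

theorem haarShear_eq (n : ℕ) : haarShear n =
    (volume : Measure (ℝ × P n × E n)).withDensity
      fun q => ENNReal.ofReal (1 / |q.1| ^ (2 * n + 1)) := by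
  have h : (volume : Measure ℝ).restrict {a : ℝ | a ≠ 0} = volume :=
    Measure.restrict_eq_self_of_ae_mem (by simp [ae_iff])
  rw [haarShear, h]
  rfl

theorem ae_haarShear_ne_zero : ∀ᵐ q ∂(haarShear n), q.1 ≠ 0 := by
  rw [haarShear_eq]
  refine (withDensity_absolutelyContinuous _ _).ae_le ?_
  exact Measure.quasiMeasurePreserving_fst.ae (by simp [ae_iff] : ∀ᵐ b : ℝ, b ≠ 0)

theorem lintegral_haarShear {F : ℝ × P n × E n → ℝ≥0∞} (hF : Measurable F) :
    ∫⁻ q, F q ∂(haarShear n) =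
      ∫⁻ q : ℝ × P n, ∫⁻ t, ENNReal.ofReal (1 / |q.1| ^ (2 * n + 1)) * F (q.1, q.2, t) := by
  have hw : Measurable fun q : ℝ × P n × E n => ENNReal.ofReal (1 / |q.1| ^ (2 * n + 1)) := by
    fun_prop
  set H : ℝ × P n × E n → ℝ≥0∞ := fun q => ENNReal.ofReal (1 / |q.1| ^ (2 * n + 1)) * F q
    with hH
  have hHm : Measurable H := hw.mul hF
  have hassoc : Measurable fun p : (ℝ × P n) × E n => (p.1.1, p.1.2, p.2) := by fun_prop
  rw [haarShear_eq, lintegral_withDensity_eq_lintegral_mul _ hw hF]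
  change ∫⁻ q, H q = ∫⁻ q : ℝ × P n, ∫⁻ t, H (q.1, q.2, t)
  rw [Measure.volume_eq_prod, lintegral_prod _ hHm.aemeasurable, Measure.volume_eq_prod ℝ,
    lintegral_prod _ (Measurable.lintegral_prod_right'
      (f := fun p : (ℝ × P n) × E n => H (p.1.1, p.1.2, p.2))
      (hHm.comp hassoc)).aemeasurable]
  refine lintegral_congr fun a => ?_
  rw [Measure.volume_eq_prod (P n), lintegral_prod (fun y : P n × E n => H (a, y))
    (hHm.comp measurable_prodMk_left).aemeasurable]

theorem SH_plancherel [NeZero n] {ψ : E n → ℍ[ℝ]} (hψ : Admissible ψ) (hc : CommutationHyp ψ)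
    {f : E n → ℍ[ℝ]} (hf : MemLp f 2 volume) :
    AEStronglyMeasurable (SH ψ f) (haarShear n) ∧
      ∫⁻ q, ‖SH ψ f q‖ₑ ^ 2 ∂(haarShear n) = admConst ψ * ∫⁻ x, ‖f x‖ₑ ^ 2 := by
  have h0 := hc.sndC_ae_eq_zero hψ.1
  have hC := admConst_eq hψ.1 h0
  have hgL := memLp_fstC hψ.1
  have hf₁L := memLp_fstC hf
  have hf₂L := memLp_sndC hf
  -- Strongly measurable representatives make the transforms jointly measurable in `(a,s,t)`, as
  -- Tonelli requires.
  obtain ⟨g, hgm, hge⟩ := hgL.1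
  obtain ⟨f₁, hf₁m, hf₁e⟩ := hf₁L.1
  obtain ⟨f₂, hf₂m, hf₂e⟩ := hf₂L.1
  rw [l2Fourier_congr hge] at hC
  have hfin := hψ.2
  rw [hC] at hfin
  set F₁ : ℝ × P n × E n → ℂ := fun q => (|q.1| ^ (1 / (4 * n : ℝ) - 1)) • shearCorr g f₁ q
  set F₂ : ℝ × P n × E n → ℂ := fun q => (|q.1| ^ (1 / (4 * n : ℝ) - 1)) • shearCorr g f₂ q
  have hF₁ : StronglyMeasurable F₁ := stronglyMeasurable_shearCorr hgm hf₁m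
  have hF₂ : StronglyMeasurable F₂ := stronglyMeasurable_shearCorr hgm hf₂m
  have hSH : SH ψ f =ᵐ[haarShear n] fun q => mkQ (F₁ q) (F₂ q) := by
    filter_upwards [ae_haarShear_ne_zero] with q hq
    exact SH_eq_mkQ hψ.1 hf h0 hge hf₁e hf₂e hq
  have hnorm : ∀ z w : ℂ, ‖mkQ z w‖ₑ ^ 2 = ‖z‖ₑ ^ 2 + ‖w‖ₑ ^ 2 := fun z w => by
    rw [enorm_sq_eq_fstC_sndC, fstC_mkQ, sndC_mkQ]
  constructor
  · exact (continuous_mkQ.comp_stronglyMeasurable (hF₁.prodMk hF₂)).aestronglyMeasurable.congr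
      hSH.symm
  · have h1 : ∫⁻ q, ‖SH ψ f q‖ₑ ^ 2 ∂(haarShear n) =
        ∫⁻ q, (‖F₁ q‖ₑ ^ 2 + ‖F₂ q‖ₑ ^ 2) ∂(haarShear n) := by
      refine lintegral_congr_ae ?_
      filter_upwards [hSH] with q hq
      rw [hq, hnorm]
    have h2 : ∫⁻ x, ‖f x‖ₑ ^ 2 = ∫⁻ x, (‖f₁ x‖ₑ ^ 2 + ‖f₂ x‖ₑ ^ 2) := by
      refine lintegral_congr_ae ?_
      filter_upwards [hf₁e, hf₂e] with x h3 h4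
      rw [enorm_sq_eq_fstC_sndC, h3, h4]
    have hg' : MemLp g 2 volume := (memLp_congr_ae hge).1 hgL
    rw [h1, h2, lintegral_add_left (hF₁.enorm.pow_const 2),
      lintegral_add_left (hf₁m.enorm.pow_const 2), lintegral_haarShear (hF₁.enorm.pow_const 2),
      lintegral_haarShear (hF₂.enorm.pow_const 2),
      lintegral_shearCorr_prod ((memLp_congr_ae hf₁e).1 hf₁L) hg' hfin,
      lintegral_shearCorr_prod ((memLp_congr_ae hf₂e).1 hf₂L) hg' hfin, hC, mul_add]

/-! ### Square integrability and polarization. -/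

theorem memLp_SH [NeZero n] {ψ : E n → ℍ[ℝ]} (hψ : Admissible ψ) (hc : CommutationHyp ψ)
    {f : E n → ℍ[ℝ]} (hf : MemLp f 2 volume) : MemLp (SH ψ f) 2 (haarShear n) := by
  obtain ⟨h1, h2⟩ := SH_plancherel hψ hc hf
  refine ⟨h1, ?_⟩
  rw [← eLpNorm_two_sq, ← eLpNorm_two_sq] at h2
  have h3 : eLpNorm (SH ψ f) 2 (haarShear n) ^ 2 < ∞ := by
    rw [h2]
    exact ENNReal.mul_lt_top hψ.2 (ENNReal.pow_lt_top hf.2)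
  exact lt_of_not_ge fun h => by simp [top_le_iff.1 h] at h3

theorem integral_norm_sq_eq {α W : Type*} [MeasurableSpace α] {μ : Measure α}
    [NormedAddCommGroup W] {F : α → W} (hF : AEStronglyMeasurable F μ) :
    ∫ x, ‖F x‖ ^ 2 ∂μ = (∫⁻ x, ‖F x‖ₑ ^ 2 ∂μ).toReal := by
  have hm : AEStronglyMeasurable (fun x => ‖F x‖ ^ 2) μ := hF.norm.pow 2
  rw [integral_eq_lintegral_of_nonneg_ae (Eventually.of_forall fun x => by positivity) hm]
  simp only [ENNReal.ofReal_pow (norm_nonneg _), ofReal_norm]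

theorem integral_norm_sq_SH [NeZero n] {ψ : E n → ℍ[ℝ]} (hψ : Admissible ψ)
    (hc : CommutationHyp ψ) {f : E n → ℍ[ℝ]} (hf : MemLp f 2 volume) :
    ∫ q, ‖SH ψ f q‖ ^ 2 ∂(haarShear n) = (admConst ψ).toReal * ∫ x, ‖f x‖ ^ 2 := by
  obtain ⟨h1, h2⟩ := SH_plancherel hψ hc hf
  rw [integral_norm_sq_eq h1, integral_norm_sq_eq hf.1, h2, ENNReal.toReal_mul]

/-- Polarization: `Sc(p q̄)` is the real inner product of `ℍ ≅ ℝ⁴`. It is used both on `L²(μ)` and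
on `L²(ℝ^{2n}, ℍ)`. -/
theorem two_mul_integral_inner {α : Type*} [MeasurableSpace α] {μ : Measure α}
    {F G : α → ℍ[ℝ]} (hF : MemLp F 2 μ) (hG : MemLp G 2 μ) :
    2 * ∫ x, (F x * star (G x)).re ∂μ =
      ∫ x, ‖F x + G x‖ ^ 2 ∂μ - ∫ x, ‖F x‖ ^ 2 ∂μ - ∫ x, ‖G x‖ ^ 2 ∂μ := by
  have i1 : Integrable (fun x => ‖F x + G x‖ ^ 2) μ := (hF.add hG).integrable_norm_pow two_ne_zero
  have i2 : Integrable (fun x => ‖F x‖ ^ 2) μ := hF.integrable_norm_pow two_ne_zero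
  have i3 : Integrable (fun x => ‖G x‖ ^ 2) μ := hG.integrable_norm_pow two_ne_zero
  have i4 : Integrable (fun x => ‖F x + G x‖ ^ 2 - ‖F x‖ ^ 2) μ := i1.sub i2
  rw [← integral_sub i1 i2, ← integral_sub i4 i3, ← integral_const_mul]
  refine integral_congr_ae (Eventually.of_forall fun x => ?_)
  simp only [norm_add_sq_real, Quaternion.inner_def]
  ring

end QShearlet

end

theorem mainTheorem1 (n : ℕ) [NeZero n] (ψ : QShearlet.E n → ℍ[ℝ])
    (hψ : QShearlet.Admissible ψ) (hcomm : QShearlet.CommutationHyp ψ) :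
    (∀ f g : QShearlet.E n → ℍ[ℝ], MemLp f 2 volume → MemLp g 2 volume →
      MemLp (QShearlet.SH ψ f) 2 (QShearlet.haarShear n) ∧
      MemLp (QShearlet.SH ψ g) 2 (QShearlet.haarShear n) ∧
      QShearlet.innerHaar (QShearlet.SH ψ f) (QShearlet.SH ψ g) =
        (QShearlet.admConst ψ).toReal * QShearlet.scInner f g) ∧
    (∀ f : QShearlet.E n → ℍ[ℝ], MemLp f 2 volume →
      ∫ q, ‖QShearlet.SH ψ f q‖ ^ 2 ∂(QShearlet.haarShear n) =
        (QShearlet.admConst ψ).toReal * (eLpNorm f 2 volume).toReal ^ 2) := by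
  refine ⟨fun f g hf hg => ?_, fun f hf => ?_⟩
  · have hF := QShearlet.memLp_SH hψ hcomm hf
    have hG := QShearlet.memLp_SH hψ hcomm hg
    refine ⟨hF, hG, ?_⟩
    have h1 := QShearlet.two_mul_integral_inner hF hG
    have h2 := QShearlet.two_mul_integral_inner hf hg
    have h3 : ∫ q, ‖QShearlet.SH ψ f q + QShearlet.SH ψ g q‖ ^ 2 ∂(QShearlet.haarShear n) =
        (QShearlet.admConst ψ).toReal * ∫ x, ‖f x + g x‖ ^ 2 := by
      have h4 := QShearlet.integral_norm_sq_SH hψ hcomm (hf.add hg)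
      simp only [Pi.add_apply] at h4
      rw [← h4]
      refine integral_congr_ae ?_
      -- For `a ≠ 0` the shearlet is in `L²`, so the defining integrals converge and can be added.
      filter_upwards [QShearlet.ae_haarShear_ne_zero] with q hq
      rw [QShearlet.SH_add hψ.1 hf hg hq]
    rw [h3, QShearlet.integral_norm_sq_SH hψ hcomm hf,
      QShearlet.integral_norm_sq_SH hψ hcomm hg] at h1
    unfold QShearlet.innerHaar QShearlet.scInner
    linear_combination h1 / 2 - (QShearlet.admConst ψ).toReal / 2 * h2
  · rw [QShearlet.integral_norm_sq_SH hψ hcomm hf, QShearlet.integral_norm_sq_eq hf.1,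
      ← QShearlet.eLpNorm_two_sq, ENNReal.toReal_pow]
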